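/- Let $(M,g)$ be a complete Riemannian manifold of dimension $n\ge 3$ with a chart at infinity, i.e. a diffeomorphism from the complement of a compact set $K\subset M$ onto the complement of a closed ball $B\subset\mathbb R^n$ centred at $0$, in which $$|g_{ij}-\delta_{ij}|=O(r^{-\tau}),\quad |\partial_k g_{ij}|=O(r^{-\tau-1}),\quad |\partial_k\partial_l g_{ij}|=O(r^{-\tau-2}),\qquad \tau>\tfrac{n-2}{2},$$ and suppose that the scalar curvature of $g$ is integrable. Then the mass $$m(g)=\lim_{r\to\infty}\int_{S_r}(\operatorname{div}_0 g-d\operatorname{tr}_0 g)(\nu)\,d\mathrm{vol}_{S_r}$$ exists; here $S_r=\{|x|=r\}$, $\nu$ is its outer unit normal, and the subscript $0$, like the surface measure, refers to the Euclidean metric of the chart. Let $H$ be the positive self-adjoint map with $g(HX,HY)=\langle X,Y\rangle_0$ on $\mathbb R^n\setminus B$, let $(e_i)$ be the standard basis of $\mathbb R^n$, and let $\omega$ be the connection form of the Levi-Civita connection $\nabla$ of $g$ in the $g$-orthonormal frame $(He_i)$, so that $\omega(X)\in\mathfrak{so}(n)$ is the endomorphism $e_j\mapsto\sum_k g(\nabla_X(He_j),He_k)\,e_k$.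 Let $(\mathbb V,\rho)$ be a finite-dimensional irreducible orthogonal (real) or unitary (complex) representation of $\mathfrak{so}(n)$; over $\mathbb R^n\setminus B$ the associated natural bundle is trivialized by the frame $(He_i)$, a constant section $\sigma\in\mathbb V$ satisfies $\nabla\sigma=\rho(\omega)\sigma=\sum_i e_i\otimes\rho(\omega(e_i))\sigma$. Let $\mathbb R^n\otimes\mathbb V=\bigoplus_{j=1}^N\mathbb W_j$ be an orthogonal decomposition into irreducible summands, with orthogonal projections $\Pi_j$. For $u,v\in\mathbb R^n$ let $u\wedge v\in\mathfrak{so}(n)$ be $X\mapsto\langle u,X\rangle v-\langle v,X\rangle u$. The conformal weight operator $B(\alpha\otimes v)=\sum_i e_i\otimes\rho(e_i\wedge\alpha)v$ of $\mathbb R^n\otimes\mathbb V$ acts on each $\mathbb W_j$ as multiplication by a real number $w(\lambda_j,\rho)$, the conformal weight of $\mathbb W_j$. Let $\mathbf a=(a_j)$ be real coefficients (for instance those of a Weitzenböck formula, i.e. such that $\sum_j a_j(\Pi_j\nabla)^*(\Pi_j\nabla)$ is an operator of order zero), let $A=\sum_j a_j\Pi_j$, and put $$\mu(\mathbf a)=-\sum_{j=1}^N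 a_j\,\frac{(\dim\mathbb W_j)\,w(\lambda_j,\rho)}{2n(n-1)} .$$ Then, for every orthonormal basis $(\sigma_\kappa)$ of $\mathbb V$, $$\lim_{r\to\infty}\Bigl(-\sum_\kappa\int_{S_r}\langle\nu\otimes\sigma_\kappa,A(\rho(\omega)\sigma_\kappa)\rangle_0\,d\mathrm{vol}_{S_r}\Bigr)=\mu(\mathbf a)\,m(g),$$ the limit on the left existing. In particular, if the limit of each single term exists, then $$-\sum_\kappa\lim_{r\to\infty}\int_{S_r}\langle\nu\otimes\sigma_\kappa,A(\rho(\omega)\sigma_\kappa)\rangle_0\,d\mathrm{vol}_{S_r}=\mu(\mathbf a)\,m(g).$$ (Dimensions are over the ground field of $\mathbb V$.) -/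

import Mathlib

open Filter Topology MeasureTheory Bundle Manifold Metric
open scoped ContDiff Matrix

attribute [local instance] LieRing.ofAssociativeRing

namespace UniversalMass

noncomputable section

/-- Euclidean space `ℝⁿ`. -/
abbrev Eucl (n : ℕ) : Type := EuclideanSpace ℝ (Fin n)

/-- The standard basis vector `e_i` of `ℝⁿ`. -/
def stdVec {n : ℕ} (i : Fin n) : Eucl n := EuclideanSpace.single i 1

/-- The partial derivative `∂_i f`. -/
def pd {n : ℕ} (i : Fin n) (f : Eucl n → ℝ) (x : Eucl n) : ℝ := fderiv ℝ f x (stdVec i)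

/-! ### Riemannian geometry of a metric given by its coefficients `G x = (g_ij(x))` -/

section Coordinates

variable {n : ℕ} (G : Eucl n → Matrix (Fin n) (Fin n) ℝ)

/-- The Christoffel symbols `Γ^k_{ij} = ½ g^{kl} (∂_i g_{jl} + ∂_j g_{il} - ∂_l g_{ij})` of the
Levi-Civita connection. -/
def christoffel (x : Eucl n) (k i j : Fin n) : ℝ :=
  (1 / 2) * ∑ l, (G x)⁻¹ k l *
    (pd i (fun y => G y j l) x + pd j (fun y => G y i l) x - pd l (fun y => G y i j) x)

/-- The Ricci curvature
`R_{ij} = ∂_k Γ^k_{ij} - ∂_j Γ^k_{ik} + Γ^k_{kl} Γ^l_{ij} - Γ^k_{jl} Γ^l_{ik}`. -/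
def ricci (x : Eucl n) (i j : Fin n) : ℝ :=
  ∑ k, (pd k (fun y => christoffel G y k i j) x - pd j (fun y => christoffel G y k i k) x) +
    ∑ k, ∑ l, (christoffel G x k k l * christoffel G x l i j -
      christoffel G x k j l * christoffel G x l i k)

/-- The scalar curvature `g^{ij} R_{ij}`. -/
def scal (x : Eucl n) : ℝ := ∑ i, ∑ j, (G x)⁻¹ i j * ricci G x i j

open scoped MatrixOrder in
/-- The positive self-adjoint map `H` with `g(HX, HY) = ⟨X, Y⟩₀`, that is `H = g^{-1/2}`. -/
def frameMap (x : Eucl n) : Matrix (Fin n) (Fin n) ℝ := CFC.sqrt (G x)⁻¹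

/-- The `l`-th coordinate of `∇_{∂_i} (H e_j)`, `∇` being the Levi-Civita connection. -/
def nablaFrame (x : Eucl n) (i j l : Fin n) : ℝ :=
  pd i (fun y => frameMap G y l j) x + ∑ m, christoffel G x l i m * frameMap G x m j

/-- The coefficients `ω_j^k(∂_i) = g(∇_{∂_i} (H e_j), H e_k)` of the connection form of the
Levi-Civita connection in the `g`-orthonormal frame `(H e_1, …, H e_n)`. -/
def connCoeff (x : Eucl n) (i j k : Fin n) : ℝ :=
  ∑ l, ∑ p, G x l p * nablaFrame G x i j l * frameMap G x p k

/-- `(div₀ g - d tr₀ g)_k = ∑_i (∂_i g_{ik} - ∂_k g_{ii})`. -/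
def massForm (x : Eucl n) (k : Fin n) : ℝ :=
  ∑ i, (pd i (fun y => G y i k) x - pd k (fun y => G y i i) x)

end Coordinates

/-- The integral `∫_{S_r} f(x, ν(x)) dvol_{S_r}` over the sphere of radius `r` centred at `0`, with
outer unit normal `ν`, for the Euclidean surface measure; here `x = r ν`. -/
def sphereIntegral {n : ℕ} {F : Type*} [NormedAddCommGroup F] [NormedSpace ℝ F]
    (f : Eucl n → Eucl n → F) (r : ℝ) : F :=
  r ^ (n - 1) • ∫ ν : sphere (0 : Eucl n) 1, f (r • (ν : Eucl n)) ν
    ∂((volume : Measure (Eucl n)).toSphere)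

/-- The flux `∫_{S_r} (div₀ g - d tr₀ g)(ν) dvol_{S_r}`. -/
def massIntegral {n : ℕ} (G : Eucl n → Matrix (Fin n) (Fin n) ℝ) (r : ℝ) : ℝ :=
  sphereIntegral (fun x ν => ∑ k, massForm G x k * ν k) r

/-- The mass `m(g) = lim_{r → ∞} ∫_{S_r} (div₀ g - d tr₀ g)(ν) dvol_{S_r}`. -/
def mass {n : ℕ} (G : Eucl n → Matrix (Fin n) (Fin n) ℝ) : ℝ :=
  limUnder atTop (massIntegral G)

/-! ### Asymptotically flat manifolds -/

/-- A chart at infinity: a diffeomorphism from the complement of a compact set onto the complement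
of a closed ball of `ℝⁿ`. -/
structure ChartAtInfinity (n : ℕ) (M : Type*) [TopologicalSpace M] [ChartedSpace (Eucl n) M] where
  /-- the compact set -/
  K : Set M
  isCompact_K : IsCompact K
  /-- the radius of the ball -/
  R : ℝ
  R_pos : 0 < R
  /-- the diffeomorphism -/
  Φ : OpenPartialHomeomorph M (Eucl n)
  source_eq : Φ.source = Kᶜ
  target_eq : Φ.target = (closedBall 0 R)ᶜ
  contMDiffOn : ContMDiffOn (𝓡 n) (𝓡 n) ∞ Φ Φ.source
  contMDiffOn_symm : ContMDiffOn (𝓡 n) (𝓡 n) ∞ Φ.symm Φ.target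

/-- The coefficients `g_ij` of the Riemannian metric of `M` in a chart at infinity. -/
def ChartAtInfinity.metric {n : ℕ} {M : Type*} [TopologicalSpace M] [ChartedSpace (Eucl n) M]
    [RiemannianBundle (fun p : M => TangentSpace (𝓡 n) p)]
    (c : ChartAtInfinity n M) (x : Eucl n) : Matrix (Fin n) (Fin n) ℝ :=
  Matrix.of fun i j =>
    inner ℝ (mfderiv (𝓡 n) (𝓡 n) c.Φ.symm x (stdVec i) : TangentSpace (𝓡 n) (c.Φ.symm x))
      (mfderiv (𝓡 n) (𝓡 n) c.Φ.symm x (stdVec j) : TangentSpace (𝓡 n) (c.Φ.symm x))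

/-- The metric of `M` is asymptotic of order `τ` to the Euclidean one in the chart `c`. -/
structure ChartAtInfinity.IsAsymptoticallyFlat {n : ℕ} {M : Type*} [TopologicalSpace M]
    [ChartedSpace (Eucl n) M] [RiemannianBundle (fun p : M => TangentSpace (𝓡 n) p)]
    (c : ChartAtInfinity n M) (τ : ℝ) : Prop where
  decay_zero : ∀ i j, (fun x => c.metric x i j - (1 : Matrix (Fin n) (Fin n) ℝ) i j)
    =O[Bornology.cobounded (Eucl n)] fun x => ‖x‖ ^ (-τ)
  decay_one : ∀ i j k, (fun x => pd k (fun y => c.metric y i j) x)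
    =O[Bornology.cobounded (Eucl n)] fun x => ‖x‖ ^ (-τ - 1)
  decay_two : ∀ i j k l, (fun x => pd k (pd l (fun y => c.metric y i j)) x)
    =O[Bornology.cobounded (Eucl n)] fun x => ‖x‖ ^ (-τ - 2)

/-- The scalar curvature is integrable, with respect to the Riemannian volume
`√(det g) dx`, over the end `M ∖ K` (over the compact set `K` it is always integrable). -/
def ChartAtInfinity.ScalIntegrable {n : ℕ} {M : Type*} [TopologicalSpace M]
    [ChartedSpace (Eucl n) M] [RiemannianBundle (fun p : M => TangentSpace (𝓡 n) p)]
    (c : ChartAtInfinity n M) : Prop :=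
  IntegrableOn (fun x => scal c.metric x * Real.sqrt (c.metric x).det) c.Φ.target

/-! ### Representations of `so(n)` -/

/-- The Lie algebra `so(n)` of skew-symmetric matrices. -/
abbrev SO (n : ℕ) : LieSubalgebra ℝ (Matrix (Fin n) (Fin n) ℝ) :=
  LieAlgebra.Orthogonal.so (Fin n) ℝ

/-- The element `u ∧ v : X ↦ ⟨u, X⟩ v - ⟨v, X⟩ u` of `so(n)`. -/
def wedge {n : ℕ} (u v : Eucl n) : SO n :=
  ⟨Matrix.of fun k j => u j * v k - v j * u k, by
    rw [LieAlgebra.Orthogonal.mem_so]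
    ext k j
    simp [Matrix.transpose_apply]
    ring⟩

/-- The value on `∂_i` of the `so(n)`-valued connection form: the skew endomorphism
`e_j ↦ ∑_k ω_j^k(∂_i) e_k`, written as `∑_{j < k} ω_j^k(∂_i) e_j ∧ e_k`. -/
def connForm {n : ℕ} (G : Eucl n → Matrix (Fin n) (Fin n) ℝ) (x : Eucl n) (i : Fin n) : SO n :=
  ∑ j, ∑ k, if j < k then connCoeff G x i j k • wedge (stdVec j) (stdVec k) else 0

/-- `W` is an irreducible invariant subspace for the family `φ` of operators. -/
structure IsIrreducibleSubspace {𝕜 L T : Type*} [Field 𝕜] [AddCommGroup T] [Module 𝕜 T]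
    (φ : L → T → T) (W : Submodule 𝕜 T) : Prop where
  invariant : ∀ X, ∀ t ∈ W, φ X t ∈ W
  ne_bot : W ≠ ⊥
  eq_bot_or_eq : ∀ U : Submodule 𝕜 T, U ≤ W → (∀ X, ∀ t ∈ U, φ X t ∈ U) → U = ⊥ ∨ U = W

/-- The space `ℝⁿ ⊗ V` with its product Hermitian structure: the tuple `(t_1, …, t_n)` stands for
`∑_i e_i ⊗ t_i`. -/
abbrev RnTensor (n : ℕ) (V : Type*) : Type _ := PiLp 2 (fun _ : Fin n => V)

section Representation

variable {n : ℕ} {𝕜 : Type*} [RCLike 𝕜] {V : Type*} [NormedAddCommGroup V] [InnerProductSpace 𝕜 V]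
  [Module ℝ V] [IsScalarTower ℝ 𝕜 V]

/-- The pure tensor `u ⊗ v`. -/
def pureTensor (𝕜 : Type*) [RCLike 𝕜] {V : Type*} [NormedAddCommGroup V] [InnerProductSpace 𝕜 V]
    (u : Eucl n) (v : V) : RnTensor n V :=
  WithLp.toLp 2 fun i => ((u i : ℝ) : 𝕜) • v

/-- An irreducible orthogonal (`𝕜 = ℝ`) or unitary (`𝕜 = ℂ`) representation. -/
structure IsIrreducibleOrthogonal (ρ : SO n →ₗ⁅ℝ⁆ Module.End 𝕜 V) : Prop where
  skew : ∀ X v w, inner 𝕜 (ρ X v) w = -inner 𝕜 v (ρ X w)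
  irreducible : IsIrreducibleSubspace (fun X v => ρ X v) (⊤ : Submodule 𝕜 V)

/-- The action `X (u ⊗ v) = X u ⊗ v + u ⊗ ρ(X) v` of `so(n)` on `ℝⁿ ⊗ V`. -/
def tensorAction (ρ : SO n →ₗ⁅ℝ⁆ Module.End 𝕜 V) (X : SO n) (t : RnTensor n V) : RnTensor n V :=
  WithLp.toLp 2 fun i =>
    ∑ j, (((X : Matrix (Fin n) (Fin n) ℝ) i j : ℝ) : 𝕜) • t j + ρ X (t i)

/-- An orthogonal decomposition `ℝⁿ ⊗ V = ⨁_j W_j` into irreducible summands. -/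
structure IsIrreducibleDecomposition (ρ : SO n →ₗ⁅ℝ⁆ Module.End 𝕜 V) {ι : Type*}
    (W : ι → Submodule 𝕜 (RnTensor n V)) : Prop where
  irreducible : ∀ j, IsIrreducibleSubspace (tensorAction ρ) (W j)
  orthogonal : Pairwise fun i j => W i ⟂ W j
  iSup_eq_top : ⨆ j, W j = ⊤

/-- The conformal weight operator `B(α ⊗ v) = ∑_i e_i ⊗ ρ(e_i ∧ α) v`. -/
def confWeightOp (ρ : SO n →ₗ⁅ℝ⁆ Module.End 𝕜 V) (t : RnTensor n V) : RnTensor n V :=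
  WithLp.toLp 2 fun i => ∑ j, ρ (wedge (stdVec i) (stdVec j)) (t j)

open Classical in
/-- The conformal weight of a summand `W` of `ℝⁿ ⊗ V`: the real number by which the conformal
weight operator acts on `W`. -/
def confWeight (ρ : SO n →ₗ⁅ℝ⁆ Module.End 𝕜 V) (W : Submodule 𝕜 (RnTensor n V)) : ℝ :=
  if h : ∃ w : ℝ, ∀ t ∈ W, confWeightOp ρ t = (w : 𝕜) • t then h.choose else 0

/-- The constant `μ(a) = -∑_j a_j (dim W_j) w(λ_j, ρ) / (2n(n-1))`. -/
def massConstant (ρ : SO n →ₗ⁅ℝ⁆ Module.End 𝕜 V) {ι : Type*} [Fintype ι]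
    (W : ι → Submodule 𝕜 (RnTensor n V)) (a : ι → ℝ) : ℝ :=
  -∑ j, a j * ((Module.finrank 𝕜 (W j) : ℝ) * confWeight ρ (W j) / (2 * n * ((n : ℝ) - 1)))

/-- The operator `A = ∑_j a_j Π_j`, where `Π_j` is the orthogonal projection onto `W_j`. -/
def weightedProj [FiniteDimensional 𝕜 V] {ι : Type*} [Fintype ι]
    (W : ι → Submodule 𝕜 (RnTensor n V)) (a : ι → ℝ) (t : RnTensor n V) : RnTensor n V :=
  ∑ j, ((a j : ℝ) : 𝕜) • (W j).starProjection t

/-- The derivative `∇σ = ρ(ω)σ = ∑_i e_i ⊗ ρ(ω(e_i))σ` of a constant section `σ`. -/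
def rhoConn (ρ : SO n →ₗ⁅ℝ⁆ Module.End 𝕜 V) (G : Eucl n → Matrix (Fin n) (Fin n) ℝ)
    (σ : V) (x : Eucl n) : RnTensor n V :=
  WithLp.toLp 2 fun i => ρ (connForm G x i) σ

/-- The boundary term `∫_{S_r} ⟨ν ⊗ σ, A(ρ(ω)σ)⟩₀ dvol_{S_r}`. -/
def boundaryIntegral [FiniteDimensional 𝕜 V] (ρ : SO n →ₗ⁅ℝ⁆ Module.End 𝕜 V) {ι : Type*}
    [Fintype ι] (W : ι → Submodule 𝕜 (RnTensor n V)) (a : ι → ℝ)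
    (G : Eucl n → Matrix (Fin n) (Fin n) ℝ) (σ : V) (r : ℝ) : 𝕜 :=
  sphereIntegral
    (fun x ν => inner 𝕜 (pureTensor 𝕜 ν σ) (weightedProj W a (rhoConn ρ G σ x))) r

end Representation

end

end UniversalMass

open UniversalMass

/-!
Since `g - δ = O(r^{-τ})`, linearizing at the Euclidean metric gives
`ω_j^k(∂_i) = (∂_j g_{ik} - ∂_k g_{ij}) / 2 + O(r^{-2τ-1})` and
`scal = div (div₀ g - d tr₀ g) + O(r^{-2τ-2})`. As `2τ + 2 > n`, the second error is integrable
near infinity, so the flux of `div₀ g - d tr₀ g` through `S_r` converges: its derivative in `r` is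
the integral of the divergence over `S_r`, which is seen by differentiating along rotations, under
which the surface measure is invariant. The first error contributes `O(r^{n-1-2τ-1}) = o(1)` to the
boundary terms, which can therefore be computed with the linearized connection.

Summed over `σ_κ`, the boundary integrand is the contraction of `ω` with the tensor
`t_{aijk} = tr (A_{ai} ∘ ρ(e_j ∧ e_k))`, where `A_{ai}` are the blocks of `A`. As `A` commutes with
`so(n)`, this tensor is invariant; since it is also skew in `j, k`, its symmetrization in `i, k` is
a multiple of `2 δ_{aj} δ_{ik} - δ_{ij} δ_{ak} - δ_{ai} δ_{jk}`, even where Levi-Civita symbols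
provide further invariants. The contraction with the linearized connection depends only on this
symmetrization, hence is a multiple of `div₀ g - d tr₀ g`, and the factor is found from the total
trace `∑_{i,j} t_{ijji} = tr (A ∘ B) = ∑_j a_j (dim W_j) w_j`.
-/

namespace UniversalMass

open Bornology

/-! ### Rotation invariant tensors -/

section InvariantTensors

variable {ι 𝕜 : Type*} [DecidableEq ι] [Field 𝕜] {t : ι → ι → ι → ι → 𝕜}

/-- Invariance of a tensor with four indices under the rotations of every coordinate plane, in
infinitesimal form: the generator `e_p ↦ e_q`, `e_q ↦ -e_p` acts on each index in turn. -/
def IsRotationInvariant (t : ι → ι → ι → ι → 𝕜) : Prop :=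
  ∀ p q a i j k,
    ((if a = p then t q i j k else 0) - if a = q then t p i j k else 0) +
    ((if i = p then t a q j k else 0) - if i = q then t a p j k else 0) +
    ((if j = p then t a i q k else 0) - if j = q then t a i p k else 0) +
    ((if k = p then t a i j q else 0) - if k = q then t a i j p else 0) = 0

/-- The tensor `2 δ_{aj} δ_{ik} - δ_{ak} δ_{ij} - δ_{ai} δ_{jk}`; contracting the first derivatives
of a metric with it gives `-2` times the integrand of the mass. -/
def massTensor (𝕜 : Type*) [Field 𝕜] (a i j k : ι) : 𝕜 :=
  2 * (if a = j then 1 else 0) * (if i = k then 1 else 0) -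
    (if a = k then 1 else 0) * (if i = j then 1 else 0) -
    (if a = i then 1 else 0) * (if j = k then 1 else 0)

omit [DecidableEq ι] in
theorem exists_ne_ne_of_three_le_card [Fintype ι] (hι : 3 ≤ Fintype.card ι) (p r : ι) :
    ∃ q, q ≠ p ∧ q ≠ r := by
  classical
  obtain ⟨q, -, hq⟩ := Finset.exists_mem_notMem_of_card_lt_card (s := {p, r})
    (t := Finset.univ) (Finset.card_le_two.trans_lt hι)
  exact ⟨q, by simpa only [Finset.mem_insert, Finset.mem_singleton, not_or] using hq⟩

omit [DecidableEq ι] in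
theorem apply_self_eq_zero_of_skew [NeZero (2 : 𝕜)] (hskew : ∀ a i j k, t a i j k = -t a i k j)
    (a i j : ι) : t a i j j = 0 := by
  have h : (2 : 𝕜) * t a i j j = 0 := by linear_combination hskew a i j j
  exact (mul_eq_zero.1 h).resolve_left two_ne_zero

namespace IsRotationInvariant

theorem apply_pair_congr_left (ht : IsRotationInvariant t) {a b i : ι} (ha : a ≠ i) (hb : b ≠ i) :
    t a i a i = t b i b i := by
  have := ht a b a i b i
  grind

theorem apply_pair_congr_right (ht : IsRotationInvariant t) {a b i : ι} (ha : a ≠ i)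
    (hb : b ≠ i) : t i a i a = t i b i b := by
  have := ht a b i a i b
  grind

variable [Fintype ι]

theorem exists_apply_pair_eq (ht : IsRotationInvariant t) (hι : 3 ≤ Fintype.card ι) :
    ∃ c, ∀ a i, a ≠ i → t a i a i = c := by
  obtain ⟨x, y, hxy⟩ := Fintype.exists_pair_of_one_lt_card (α := ι) (by omega)
  refine ⟨t x y x y, fun a i hai => ?_⟩
  obtain ⟨q, hqi, hqy⟩ := exists_ne_ne_of_three_le_card hι i y
  calc t a i a i = t q i q i := ht.apply_pair_congr_left hai hqi
    _ = t q y q y := ht.apply_pair_congr_right hqi.symm hqy.symm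
    _ = t x y x y := ht.apply_pair_congr_left hqy hxy

theorem apply_self_self_eq_zero (ht : IsRotationInvariant t) (hι : 3 ≤ Fintype.card ι) {p r : ι}
    (hpr : p ≠ r) : t r r p r = 0 := by
  obtain ⟨q, hqp, hqr⟩ := exists_ne_ne_of_three_le_card hι p r
  have := ht p q r r q r
  grind

theorem apply_eq_zero_of_distinct (ht : IsRotationInvariant t) (hι : 3 ≤ Fintype.card ι)
    {p q r : ι} (hpq : p ≠ q) (hpr : p ≠ r) (hqr : q ≠ r) :
    t p r q r = 0 ∧ t r p q r = 0 ∧ t r r q p = 0 := by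
  have e1 := ht p r r r q r
  have e2 := ht p r p r q p
  have e3 := ht p r r p q p
  have e4 := ht.apply_self_self_eq_zero hι hpq.symm
  simp only [hpr, hqr, hpq.symm, hpr.symm, if_true, if_false] at e1 e2 e3
  exact ⟨by linear_combination -e1 - e3 - e4, by linear_combination -e1 - e2 - e4,
    by linear_combination e1 + e2 + e3 + 2 * e4⟩

theorem add_swap_eq_zero_of_distinct (ht : IsRotationInvariant t) (hι : 3 ≤ Fintype.card ι)
    {i j k : ι} (hij : i ≠ j) (hjk : j ≠ k) (hik : i ≠ k) (a : ι) :
    t a i j k + t a k j i = 0 := by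
  rcases eq_or_ne a i with rfl | hai
  · obtain ⟨-, h, h'⟩ := ht.apply_eq_zero_of_distinct hι hjk.symm hik.symm hij.symm
    rw [h, h', add_zero]
  rcases eq_or_ne a k with rfl | hak
  · obtain ⟨-, h, h'⟩ := ht.apply_eq_zero_of_distinct hι hij hik hjk
    rw [h, h', add_zero]
  have := ht i k a i j i
  grind

variable [NeZero (2 : 𝕜)]

theorem exists_apply_eq_of_skew (ht : IsRotationInvariant t) (hι : 3 ≤ Fintype.card ι)
    (hskew : ∀ a i j k, t a i j k = -t a i k j) :
    ∃ c : 𝕜, ∀ a i j,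
      t a i j i = c * ((if a = j then 1 else 0) - if a = i ∧ i = j then 1 else 0) := by
  obtain ⟨c, hc⟩ := ht.exists_apply_pair_eq hι
  refine ⟨c, fun a i j => ?_⟩
  rcases eq_or_ne i j with rfl | hij
  · simp [apply_self_eq_zero_of_skew hskew]
  rcases eq_or_ne a j with rfl | haj
  · simp [hc a i hij.symm, hij]
  rcases eq_or_ne a i with rfl | hai
  · simp [ht.apply_self_self_eq_zero hι hij.symm, hij]
  · simp [(ht.apply_eq_zero_of_distinct hι haj hai hij.symm).1, haj, hij]

theorem exists_add_swap_eq_mul_massTensor (ht : IsRotationInvariant t)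
    (hι : 3 ≤ Fintype.card ι) (hskew : ∀ a i j k, t a i j k = -t a i k j) :
    ∃ c : 𝕜, ∀ a i j k, t a i j k + t a k j i = c * massTensor 𝕜 a i j k := by
  obtain ⟨c, hc⟩ := ht.exists_apply_eq_of_skew hι hskew
  refine ⟨c, fun a i j k => ?_⟩
  have hzero := apply_self_eq_zero_of_skew hskew
  rcases eq_or_ne i k with rfl | hik
  · rw [hc, massTensor]
    grind
  rcases eq_or_ne j k with rfl | hjk
  · rw [hzero, hskew a j j i, hc, massTensor]
    grind
  rcases eq_or_ne i j with rfl | hij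
  · rw [hzero, hskew a i i k, hc, massTensor]
    grind
  · simp [ht.add_swap_eq_zero_of_distinct hι hij hjk hik, massTensor, hik, hij, hjk]

end IsRotationInvariant

theorem sum_mul_massTensor [Fintype ι] {D : ι → ι → ι → 𝕜} (hD : ∀ j i k, D j i k = D j k i)
    (a : ι) :
    ∑ i, ∑ j, ∑ k, D j i k * massTensor 𝕜 a i j k = -2 * ∑ i, (D i i a - D a i i) := by
  have h (i j k : ι) : D j i k * massTensor 𝕜 a i j k =
      (if a = j then if i = k then 2 * D j i k else 0 else 0) -
        (if i = j then if a = k then D j i k else 0 else 0) -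
        (if a = i then if j = k then D j i k else 0 else 0) := by
    rw [massTensor]
    split_ifs <;> ring
  simp only [h, Finset.sum_sub_distrib, Finset.sum_ite_irrel, Finset.sum_const_zero,
    Finset.sum_ite_eq, Finset.mem_univ, if_true, ← Finset.mul_sum, hD _ a]
  ring

theorem sum_apply_eq_of_add_swap_eq [Fintype ι] [NeZero (2 : 𝕜)]
    (hskew : ∀ a i j k, t a i j k = -t a i k j) {c : 𝕜}
    (hsym : ∀ a i j k, t a i j k + t a k j i = c * massTensor 𝕜 a i j k) :
    ∑ i, ∑ j, t i j j i = -c * (Fintype.card ι * (Fintype.card ι - 1)) := by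
  have h (i j : ι) : t i j j i = c * ((if i = j then 1 else 0) - 1) := by
    have hij := hsym i j i j
    rw [hskew i j j i]
    apply mul_left_cancel₀ (two_ne_zero : (2 : 𝕜) ≠ 0)
    by_cases hne : i = j
    · simp only [massTensor, hne, if_true] at hij ⊢
      linear_combination -hij
    · simp only [massTensor, hne, Ne.symm hne, if_true, if_false] at hij ⊢
      linear_combination -hij
  simp only [h, ← Finset.mul_sum, Finset.sum_sub_distrib, Finset.sum_ite_eq, Finset.mem_univ,
    if_true, Finset.sum_const, Finset.card_univ, nsmul_eq_mul, mul_one]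
  ring

section Contraction

omit [DecidableEq ι]

variable [Fintype ι]

theorem two_mul_sum_lt_eq_sum [LinearOrder ι] {f : ι → ι → 𝕜} (hf : ∀ j k, f j k = f k j)
    (hdiag : ∀ j, f j j = 0) :
    2 * ∑ j, ∑ k, (if j < k then f j k else 0) = ∑ j, ∑ k, f j k := by
  have h (j k : ι) : f j k = (if j < k then f j k else 0) + if k < j then f k j else 0 := by
    rcases lt_trichotomy j k with hjk | rfl | hjk
    · simp [hjk, hjk.not_gt]
    · simp [hdiag]
    · simp [hjk, hjk.not_gt, hf j k]
  calc 2 * ∑ j, ∑ k, (if j < k then f j k else 0)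
      = ∑ j, ∑ k, (if j < k then f j k else 0) + ∑ j, ∑ k, (if k < j then f k j else 0) := by
        rw [two_mul, Finset.sum_comm (f := fun j k => if k < j then f k j else 0)]
    _ = ∑ j, ∑ k, f j k := by simp only [← Finset.sum_add_distrib, ← h]

/-- The contraction `∑_i ∑_{j < k} θ_{ijk} t_{aijk}` of a tensor, skew in its last two indices, with
an `so(n)`-valued one-form `θ = (θ_{ijk})`. -/
def formContraction [LinearOrder ι] (t : ι → ι → ι → ι → 𝕜) (θ : ι → ι → ι → 𝕜) (a : ι) : 𝕜 :=
  ∑ i, ∑ j, ∑ k, if j < k then θ i j k * t a i j k else 0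

theorem formContraction_sub [LinearOrder ι] (t : ι → ι → ι → ι → 𝕜) (θ η : ι → ι → ι → 𝕜) (a : ι) :
    formContraction t (fun i j k => θ i j k - η i j k) a =
      formContraction t θ a - formContraction t η a := by
  simp only [formContraction, ← Finset.sum_sub_distrib]
  refine Finset.sum_congr rfl fun i _ => Finset.sum_congr rfl fun j _ =>
    Finset.sum_congr rfl fun k _ => ?_
  split_ifs
  · exact sub_mul _ _ _
  · exact (sub_zero 0).symm

theorem sum_skew_mul (hskew : ∀ a i j k, t a i j k = -t a i k j) (D : ι → ι → ι → 𝕜) (a : ι) :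
    ∑ i, ∑ j, ∑ k, (D j i k - D k i j) * t a i j k =
      2 * ∑ i, ∑ j, ∑ k, D j i k * t a i j k := by
  have h (i : ι) : ∑ j, ∑ k, D k i j * t a i j k = -∑ j, ∑ k, D j i k * t a i j k := by
    rw [Finset.sum_comm]
    simp only [← Finset.sum_neg_distrib]
    refine Finset.sum_congr rfl fun j _ => Finset.sum_congr rfl fun k _ => ?_
    rw [hskew a i k j, mul_neg]
  simp only [sub_mul, Finset.sum_sub_distrib, h, Finset.sum_neg_distrib]
  ring

theorem two_mul_sum_eq_sum_add_swap {D : ι → ι → ι → 𝕜} (hD : ∀ j i k, D j i k = D j k i)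
    (t : ι → ι → ι → ι → 𝕜) (a : ι) :
    2 * ∑ i, ∑ j, ∑ k, D j i k * t a i j k =
      ∑ i, ∑ j, ∑ k, D j i k * (t a i j k + t a k j i) := by
  have h : ∑ i, ∑ j, ∑ k, D j i k * t a k j i = ∑ i, ∑ j, ∑ k, D j i k * t a i j k := by
    rw [Finset.sum_comm, Finset.sum_comm (f := fun i j => ∑ k, D j i k * t a i j k)]
    refine Finset.sum_congr rfl fun j _ => ?_
    rw [Finset.sum_comm]
    simp only [hD j]
  simp only [mul_add, Finset.sum_add_distrib, h, two_mul]

end Contraction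

theorem formContraction_eq_of_add_swap_eq [Fintype ι] [LinearOrder ι] [NeZero (2 : 𝕜)]
    (hskew : ∀ a i j k, t a i j k = -t a i k j) {c : 𝕜}
    (hsym : ∀ a i j k, t a i j k + t a k j i = c * massTensor 𝕜 a i j k)
    {D : ι → ι → ι → 𝕜} (hD : ∀ j i k, D j i k = D j k i) (a : ι) :
    formContraction t (fun i j k => 1 / 2 * (D j i k - D k i j)) a =
      -(c / 2) * ∑ i, (D i i a - D a i i) := by
  have h2 : (2 : 𝕜) ≠ 0 := two_ne_zero
  have hlt : 2 * formContraction t (fun i j k => 1 / 2 * (D j i k - D k i j)) a =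
      1 / 2 * ∑ i, ∑ j, ∑ k, (D j i k - D k i j) * t a i j k := by
    calc 2 * formContraction t (fun i j k => 1 / 2 * (D j i k - D k i j)) a
        = ∑ i, ∑ j, ∑ k, 1 / 2 * (D j i k - D k i j) * t a i j k := by
          rw [formContraction, Finset.mul_sum]
          refine Finset.sum_congr rfl fun i _ => two_mul_sum_lt_eq_sum (fun j k => ?_) fun j => ?_
          · rw [hskew a i k j]
            ring
          · rw [sub_self, mul_zero, zero_mul]
      _ = _ := by simp only [mul_assoc, ← Finset.mul_sum]
  have hfull := sum_skew_mul hskew D a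
  have hswap := two_mul_sum_eq_sum_add_swap hD t a
  have hmass := sum_mul_massTensor hD a
  simp only [hsym, mul_left_comm _ c, ← Finset.mul_sum, hmass] at hswap
  rw [hfull, one_div, inv_mul_cancel_left₀ h2] at hlt
  rw [one_div]
  have hhalf : 2 * (c / 2) = c := mul_div_cancel₀ c h2
  apply mul_left_cancel₀ (mul_ne_zero h2 h2)
  linear_combination 2 * hlt + hswap + 2 * (∑ i, (D i i a - D a i i)) * hhalf

end InvariantTensors

/-! ### The conformal weight operator -/

/-- Schur's lemma for symmetric operators, valid over the reals as well as over the complex numbers: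
every eigenspace in `W` is invariant. -/
theorem IsIrreducibleSubspace.exists_eq_smul {𝕜 L T : Type*} [RCLike 𝕜] [NormedAddCommGroup T]
    [InnerProductSpace 𝕜 T] [FiniteDimensional 𝕜 T] {φ : L → T →ₗ[𝕜] T} {W : Submodule 𝕜 T}
    (hW : IsIrreducibleSubspace (fun X t => φ X t) W) {S : T →ₗ[𝕜] T} (hS : S.IsSymmetric)
    (hSW : ∀ t ∈ W, S t ∈ W) (hcomm : ∀ X, ∀ t ∈ W, S (φ X t) = φ X (S t)) :
    ∃ w : ℝ, ∀ t ∈ W, S t = (w : 𝕜) • t := by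
  have : Nontrivial W := Submodule.nontrivial_iff_ne_bot.2 hW.ne_bot
  obtain ⟨w, hw⟩ : ∃ w : ℝ, Module.End.HasEigenvalue (S.restrict hSW) (w : 𝕜) :=
    ⟨_, (hS.restrict_invariant hSW).hasEigenvalue_iSup_of_finiteDimensional⟩
  obtain ⟨v, hv⟩ := hw.exists_hasEigenvector
  let U : Submodule 𝕜 T := W ⊓ LinearMap.ker (S - (w : 𝕜) • LinearMap.id)
  have mem_U (t : T) : t ∈ U ↔ t ∈ W ∧ S t = (w : 𝕜) • t := by simp [U, sub_eq_zero]
  have hvU : (v : T) ∈ U :=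
    (mem_U _).2 ⟨v.2, by simpa using congrArg Subtype.val hv.apply_eq_smul⟩
  have hU := hW.eq_bot_or_eq U inf_le_left fun X t ht => by
    obtain ⟨htW, hSt⟩ := (mem_U t).1 ht
    exact (mem_U _).2 ⟨hW.invariant X t htW, by rw [hcomm X t htW, hSt, map_smul]⟩
  rcases hU with hU | hU
  · rw [hU, Submodule.mem_bot] at hvU
    exact absurd (Subtype.ext hvU) hv.2
  · exact ⟨w, fun t ht => ((mem_U t).1 (hU ▸ ht)).2⟩

theorem starProjection_map_of_invariant {𝕜 T : Type*} [RCLike 𝕜] [NormedAddCommGroup T]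
    [InnerProductSpace 𝕜 T] {W : Submodule 𝕜 T} [W.HasOrthogonalProjection] {S S' : T →ₗ[𝕜] T}
    (hadj : ∀ s t, inner 𝕜 (S' s) t = inner 𝕜 s (S t)) (hS : ∀ t ∈ W, S t ∈ W)
    (hS' : ∀ t ∈ W, S' t ∈ W) (t : T) : W.starProjection (S t) = S (W.starProjection t) := by
  refine Submodule.eq_starProjection_of_mem_orthogonal (hS _ (W.starProjection_apply_mem t)) ?_
  rw [← map_sub, Submodule.mem_orthogonal]
  intro u hu
  rw [← hadj]
  exact (W.mem_orthogonal _).1 (W.sub_starProjection_mem_orthogonal t) _ (hS' u hu)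

section Wedge

variable {n : ℕ}

theorem stdVec_apply (i j : Fin n) : stdVec i j = if j = i then 1 else 0 := by
  simp [stdVec]

theorem wedge_apply (u v : Eucl n) (k j : Fin n) : (wedge u v).1 k j = u j * v k - v j * u k :=
  rfl

theorem wedge_swap (u v : Eucl n) : wedge u v = -wedge v u := by
  ext k j
  simp [wedge_apply]

theorem skew_apply (X : SO n) (i j : Fin n) : X.1 i j = -X.1 j i := by
  simpa using congrFun (congrFun ((LieAlgebra.Orthogonal.mem_so _ _ _).1 X.2) j) i

theorem lie_wedge (X : SO n) (i j : Fin n) :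
    ⁅X, wedge (stdVec i) (stdVec j)⁆ =
      ∑ k, (X.1 k i • wedge (stdVec k) (stdVec j) + X.1 k j • wedge (stdVec i) (stdVec k)) := by
  ext p q
  have hsum : (∑ k, (X.1 k i • wedge (stdVec k) (stdVec j) +
      X.1 k j • wedge (stdVec i) (stdVec k))).1 p q =
      ∑ k, (X.1 k i * (wedge (stdVec k) (stdVec j)).1 p q +
        X.1 k j * (wedge (stdVec i) (stdVec k)).1 p q) := by
    rw [AddSubmonoidClass.coe_finsetSum, Matrix.sum_apply]
    rfl
  rw [hsum, LieSubalgebra.coe_bracket, Ring.lie_def, Matrix.sub_apply, Matrix.mul_apply,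
    Matrix.mul_apply]
  simp only [wedge_apply, stdVec_apply, mul_sub, sub_mul, mul_ite, ite_mul, mul_one, one_mul,
    mul_zero, zero_mul, Finset.sum_sub_distrib, Finset.sum_add_distrib, Finset.sum_ite_eq,
    Finset.sum_ite_eq', Finset.mem_univ, if_true]
  by_cases h1 : p = j <;> by_cases h2 : p = i <;> simp [h1, h2, skew_apply X q] <;>
    split_ifs <;> ring

theorem sum_skew_smul_eq_zero {𝕜 M : Type*} [RCLike 𝕜] [AddCommGroup M] [Module 𝕜 M] (X : SO n)
    {f : Fin n → Fin n → M} (hf : ∀ i k, f i k = f k i) :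
    ∑ i, ∑ k, (X.1 k i : 𝕜) • f i k = 0 := by
  have h : ∑ i, ∑ k, (X.1 k i : 𝕜) • f i k = -∑ i, ∑ k, (X.1 k i : 𝕜) • f i k := by
    conv_lhs => rw [Finset.sum_comm]
    simp only [← Finset.sum_neg_distrib]
    refine Finset.sum_congr rfl fun k _ => Finset.sum_congr rfl fun i _ => ?_
    rw [skew_apply X k i, hf i k, RCLike.ofReal_neg, neg_smul]
  have h2 : (2 : 𝕜) • ∑ i, ∑ k, (X.1 k i : 𝕜) • f i k = 0 := by
    rw [two_smul]
    nth_rewrite 1 [h]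
    exact neg_add_cancel _
  exact (smul_eq_zero.1 h2).resolve_left two_ne_zero

end Wedge

section Casimir

variable {n : ℕ} {𝕜 : Type*} [RCLike 𝕜] {V : Type*} [NormedAddCommGroup V] [InnerProductSpace 𝕜 V]
  [Module ℝ V] [IsScalarTower ℝ 𝕜 V] (ρ : SO n →ₗ⁅ℝ⁆ Module.End 𝕜 V)

/-- The operator `ρ(e_i ∧ e_j)`. -/
noncomputable def rhoWedge (i j : Fin n) : Module.End 𝕜 V := ρ (wedge (stdVec i) (stdVec j))

theorem rhoWedge_swap (i j : Fin n) : rhoWedge ρ i j = -rhoWedge ρ j i := by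
  rw [rhoWedge, wedge_swap, map_neg, rhoWedge]

theorem rho_mul_rhoWedge (X : SO n) (i j : Fin n) :
    ρ X * rhoWedge ρ i j = rhoWedge ρ i j * ρ X +
      ∑ k, ((X.1 k i : 𝕜) • rhoWedge ρ k j + (X.1 k j : 𝕜) • rhoWedge ρ i k) := by
  have h := congrArg ρ (lie_wedge X i j)
  simp only [LieHom.map_lie, Ring.lie_def, map_sum, map_add, map_smul,
    RCLike.real_smul_eq_coe_smul (K := 𝕜)] at h
  exact sub_eq_iff_eq_add'.1 h

/-- The Casimir operator `∑_{i,j} ρ(e_i ∧ e_j)²`. -/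
noncomputable def casimir : Module.End 𝕜 V := ∑ i, ∑ j, rhoWedge ρ i j * rhoWedge ρ i j

theorem casimir_apply (v : V) :
    casimir ρ v = ∑ i, ∑ j, rhoWedge ρ i j (rhoWedge ρ i j v) := by
  simp [casimir, LinearMap.sum_apply]

theorem rho_mul_casimir (X : SO n) : ρ X * casimir ρ = casimir ρ * ρ X := by
  have hterm (i j : Fin n) : ρ X * (rhoWedge ρ i j * rhoWedge ρ i j) =
      rhoWedge ρ i j * rhoWedge ρ i j * ρ X +
        (∑ k, (X.1 k i : 𝕜) • (rhoWedge ρ k j * rhoWedge ρ i j + rhoWedge ρ i j * rhoWedge ρ k j) +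
        ∑ k, (X.1 k j : 𝕜) •
          (rhoWedge ρ i k * rhoWedge ρ i j + rhoWedge ρ i j * rhoWedge ρ i k)) := by
    rw [← mul_assoc, rho_mul_rhoWedge, add_mul, mul_assoc, rho_mul_rhoWedge, mul_add]
    simp only [Finset.sum_mul, Finset.mul_sum, add_mul, mul_add, smul_mul_assoc, mul_smul_comm,
      Finset.sum_add_distrib, smul_add, mul_assoc]
    abel
  have hfst (j : Fin n) := sum_skew_smul_eq_zero (𝕜 := 𝕜) X
    (f := fun i k => rhoWedge ρ k j * rhoWedge ρ i j + rhoWedge ρ i j * rhoWedge ρ k j)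
    fun _ _ => add_comm _ _
  have hsnd (i : Fin n) := sum_skew_smul_eq_zero (𝕜 := 𝕜) X
    (f := fun j k => rhoWedge ρ i k * rhoWedge ρ i j + rhoWedge ρ i j * rhoWedge ρ i k)
    fun _ _ => add_comm _ _
  simp only [casimir, Finset.mul_sum, Finset.sum_mul, hterm, Finset.sum_add_distrib, hsnd]
  rw [Finset.sum_comm (f := fun i j => ∑ k, (X.1 k i : 𝕜) • _)]
  simp only [hfst, Finset.sum_const_zero, add_zero]

variable {ρ}

theorem rhoWedge_skew (hρ : ∀ X v w, inner 𝕜 (ρ X v) w = -inner 𝕜 v (ρ X w)) (i j : Fin n)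
    (v w : V) : inner 𝕜 (rhoWedge ρ i j v) w = inner 𝕜 v (rhoWedge ρ j i w) := by
  rw [rhoWedge_swap ρ j i, LinearMap.neg_apply, inner_neg_right]
  exact hρ _ _ _

theorem casimir_isSymmetric (hρ : ∀ X v w, inner 𝕜 (ρ X v) w = -inner 𝕜 v (ρ X w)) :
    (casimir ρ).IsSymmetric := by
  intro v w
  simp only [casimir_apply, sum_inner, inner_sum, rhoWedge_skew hρ]
  exact Finset.sum_comm

theorem IsIrreducibleOrthogonal.exists_casimir_eq [FiniteDimensional 𝕜 V]
    (hρ : IsIrreducibleOrthogonal ρ) : ∃ c : ℝ, ∀ v, casimir ρ v = (c : 𝕜) • v := by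
  obtain ⟨c, hc⟩ := hρ.irreducible.exists_eq_smul (φ := fun X => ρ X)
    (casimir_isSymmetric hρ.skew) (fun _ _ => Submodule.mem_top)
    fun X v _ => (LinearMap.congr_fun (rho_mul_casimir ρ X) v).symm
  exact ⟨c, fun v => hc v Submodule.mem_top⟩

end Casimir

section ConformalWeight

variable {n : ℕ} {𝕜 : Type*} [RCLike 𝕜] {V : Type*} [NormedAddCommGroup V] [InnerProductSpace 𝕜 V]
  [Module ℝ V] [IsScalarTower ℝ 𝕜 V] (ρ : SO n →ₗ⁅ℝ⁆ Module.End 𝕜 V)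

/-- The operator `tensorAction ρ X` as a linear map. -/
noncomputable def tensorActionLin (X : SO n) : RnTensor n V →ₗ[𝕜] RnTensor n V where
  toFun := tensorAction ρ X
  map_add' s t := by
    ext i
    simp [tensorAction, Finset.sum_add_distrib]
    abel
  map_smul' c t := by
    ext i
    simp [tensorAction, Finset.smul_sum, smul_comm c]

/-- The operator `confWeightOp ρ` as a linear map. -/
noncomputable def confWeightLin : RnTensor n V →ₗ[𝕜] RnTensor n V where
  toFun := confWeightOp ρ
  map_add' s t := by
    ext i
    simp [confWeightOp, Finset.sum_add_distrib]
  map_smul' c t := by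
    ext i
    simp [confWeightOp, Finset.smul_sum]

theorem tensorAction_apply (X : SO n) (t : RnTensor n V) (i : Fin n) :
    tensorAction ρ X t i = ∑ j, (X.1 i j : 𝕜) • t j + ρ X (t i) := rfl

theorem confWeightOp_apply (t : RnTensor n V) (i : Fin n) :
    confWeightOp ρ t i = ∑ j, rhoWedge ρ i j (t j) := rfl

theorem confWeightOp_tensorAction (X : SO n) (t : RnTensor n V) :
    confWeightOp ρ (tensorAction ρ X t) = tensorAction ρ X (confWeightOp ρ t) := by
  ext k
  have hρ (i j : Fin n) (v : V) := LinearMap.congr_fun (rho_mul_rhoWedge ρ X i j) v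
  simp only [Module.End.mul_apply, LinearMap.add_apply, LinearMap.sum_apply,
    LinearMap.smul_apply] at hρ
  simp only [confWeightOp_apply, tensorAction_apply, map_add, map_sum, map_smul, hρ,
    Finset.sum_add_distrib, Finset.smul_sum, skew_apply X k, RCLike.ofReal_neg, neg_smul,
    Finset.sum_neg_distrib]
  rw [Finset.sum_comm (f := fun i j => (X.1 i k : 𝕜) • _),
    Finset.sum_comm (f := fun i j => (X.1 j i : 𝕜) • _)]
  abel

theorem tensorAction_wedge_apply (i j : Fin n) (t : RnTensor n V) (k : Fin n) :
    tensorAction ρ (wedge (stdVec i) (stdVec j)) t k =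
      (if k = j then t i else 0) - (if k = i then t j else 0) + rhoWedge ρ i j (t k) := by
  rw [tensorAction_apply, rhoWedge]
  congr 1
  simp only [wedge_apply, stdVec_apply, RCLike.ofReal_sub, sub_smul,
    Finset.sum_sub_distrib, ite_mul, one_mul, zero_mul, ite_smul, one_smul,
    zero_smul, Finset.sum_ite_eq', Finset.mem_univ, if_true, RCLike.ofReal_zero, RCLike.ofReal_one,
    apply_ite (RCLike.ofReal (K := 𝕜))]

/-- The cross term of `(X ⊗ 1 + 1 ⊗ X)²`, summed over the `X = e_i ∧ e_j`, is a multiple of the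
conformal weight operator. -/
theorem sum_tensorAction_wedge_sq (t : RnTensor n V) (k : Fin n) :
    (∑ i, ∑ j, tensorAction ρ (wedge (stdVec i) (stdVec j))
      (tensorAction ρ (wedge (stdVec i) (stdVec j)) t)) k =
      casimir ρ (t k) - (4 : 𝕜) • confWeightOp ρ t k - (2 * ((n : 𝕜) - 1)) • t k := by
  have hswap (i : Fin n) : rhoWedge ρ i k (t i) = -rhoWedge ρ k i (t i) := by
    rw [rhoWedge_swap, LinearMap.neg_apply]
  simp only [WithLp.ofLp_sum, Finset.sum_apply, tensorAction_wedge_apply, map_add, map_sub,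
    Finset.sum_add_distrib, Finset.sum_sub_distrib, apply_ite (rhoWedge ρ _ _), map_zero,
    Finset.sum_ite_eq, Finset.sum_ite_eq', Finset.mem_univ, if_true, Finset.sum_ite_irrel,
    Finset.sum_const_zero, casimir_apply, confWeightOp_apply, hswap, Finset.sum_neg_distrib,
    Finset.sum_const, Finset.card_univ, Fintype.card_fin, ← Nat.cast_smul_eq_nsmul 𝕜]
  module

variable {ρ}

theorem confWeightLin_isSymmetric (hρ : ∀ X v w, inner 𝕜 (ρ X v) w = -inner 𝕜 v (ρ X w)) :
    (confWeightLin ρ).IsSymmetric := by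
  intro s t
  change inner 𝕜 (confWeightOp ρ s) t = inner 𝕜 s (confWeightOp ρ t)
  simp only [PiLp.inner_apply, confWeightOp_apply, sum_inner, inner_sum, rhoWedge_skew hρ]
  exact Finset.sum_comm

theorem tensorAction_skew (hρ : ∀ X v w, inner 𝕜 (ρ X v) w = -inner 𝕜 v (ρ X w)) (X : SO n)
    (s t : RnTensor n V) :
    inner 𝕜 (tensorAction ρ X s) t = -inner 𝕜 s (tensorAction ρ X t) := by
  have hcross : ∑ i, ∑ j, (X.1 i j : 𝕜) * inner 𝕜 (s j) (t i) =
      -∑ i, ∑ j, (X.1 i j : 𝕜) * inner 𝕜 (s i) (t j) := by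
    rw [Finset.sum_comm]
    simp only [← Finset.sum_neg_distrib]
    refine Finset.sum_congr rfl fun i _ => Finset.sum_congr rfl fun j _ => ?_
    rw [skew_apply X j i, RCLike.ofReal_neg, neg_mul]
  simp only [PiLp.inner_apply, tensorAction_apply, inner_add_left, inner_add_right, sum_inner,
    inner_sum, inner_smul_left, inner_smul_right, hρ, RCLike.conj_ofReal,
    Finset.sum_add_distrib, Finset.sum_neg_distrib, neg_add, hcross]

variable [FiniteDimensional 𝕜 V] {W : Submodule 𝕜 (RnTensor n V)}

theorem IsIrreducibleOrthogonal.exists_confWeightOp_eq_smul (hρ : IsIrreducibleOrthogonal ρ)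
    (hW : IsIrreducibleSubspace (tensorAction ρ) W) :
    ∃ w : ℝ, ∀ t ∈ W, confWeightOp ρ t = (w : 𝕜) • t := by
  obtain ⟨c, hc⟩ := hρ.exists_casimir_eq
  have hB (t : RnTensor n V) : confWeightOp ρ t =
      (4 : 𝕜)⁻¹ • ((c : 𝕜) • t - (2 * ((n : 𝕜) - 1)) • t -
        ∑ i, ∑ j, tensorAction ρ (wedge (stdVec i) (stdVec j))
          (tensorAction ρ (wedge (stdVec i) (stdVec j)) t)) := by
    ext k
    simp only [PiLp.smul_apply, PiLp.sub_apply, sum_tensorAction_wedge_sq, hc]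
    module
  refine hW.exists_eq_smul (φ := tensorActionLin ρ) (S := confWeightLin ρ)
    (confWeightLin_isSymmetric hρ.skew) (fun t ht => ?_)
    fun X t _ => confWeightOp_tensorAction ρ X t
  change confWeightOp ρ t ∈ W
  rw [hB]
  refine W.smul_mem _ (W.sub_mem (W.sub_mem (W.smul_mem _ ht) (W.smul_mem _ ht)) ?_)
  exact W.sum_mem fun i _ => W.sum_mem fun j _ => hW.invariant _ _ (hW.invariant _ _ ht)

theorem IsIrreducibleOrthogonal.confWeightOp_eq_confWeight_smul (hρ : IsIrreducibleOrthogonal ρ)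
    (hW : IsIrreducibleSubspace (tensorAction ρ) W) {t : RnTensor n V} (ht : t ∈ W) :
    confWeightOp ρ t = (confWeight ρ W : 𝕜) • t := by
  have h := hρ.exists_confWeightOp_eq_smul hW
  rw [confWeight, dif_pos h]
  exact h.choose_spec t ht

end ConformalWeight

/-! ### The trace tensor -/

section Blocks

variable {n : ℕ} {𝕜 : Type*} [RCLike 𝕜] {V : Type*} [NormedAddCommGroup V] [InnerProductSpace 𝕜 V]

/-- The map `v ↦ e_i ⊗ v`. -/
noncomputable def tensorSingle (𝕜 : Type*) [RCLike 𝕜] {V : Type*} [NormedAddCommGroup V]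
    [InnerProductSpace 𝕜 V] (i : Fin n) : V →ₗ[𝕜] RnTensor n V :=
  (WithLp.linearEquiv 2 𝕜 (Fin n → V)).symm.toLinearMap ∘ₗ LinearMap.single 𝕜 (fun _ => V) i

theorem tensorSingle_apply (i : Fin n) (v : V) (k : Fin n) :
    tensorSingle 𝕜 i v k = if k = i then v else 0 :=
  Pi.single_apply i v k

theorem sum_tensorSingle (t : RnTensor n V) : ∑ i, tensorSingle 𝕜 i (t i) = t := by
  ext k
  simp [WithLp.ofLp_sum, Finset.sum_apply, tensorSingle_apply]

/-- The blocks `A_{ai} ∈ End V` of an endomorphism `A` of `ℝⁿ ⊗ V`. -/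
noncomputable def blockOp (A : RnTensor n V →ₗ[𝕜] RnTensor n V) (a i : Fin n) : Module.End 𝕜 V :=
  PiLp.projₗ 2 (fun _ => V) a ∘ₗ A ∘ₗ tensorSingle 𝕜 i

theorem blockOp_apply (A : RnTensor n V →ₗ[𝕜] RnTensor n V) (a i : Fin n) (v : V) :
    blockOp A a i v = A (tensorSingle 𝕜 i v) a := rfl

theorem apply_eq_sum_blockOp (A : RnTensor n V →ₗ[𝕜] RnTensor n V) (t : RnTensor n V) (a : Fin n) :
    A t a = ∑ i, blockOp A a i (t i) := by
  conv_lhs => rw [← sum_tensorSingle (𝕜 := 𝕜) t]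
  simp [WithLp.ofLp_sum, Finset.sum_apply, blockOp_apply]

theorem trace_eq_sum_trace_blockOp [FiniteDimensional 𝕜 V] (A : RnTensor n V →ₗ[𝕜] RnTensor n V) :
    LinearMap.trace 𝕜 _ A = ∑ i, LinearMap.trace 𝕜 V (blockOp A i i) := by
  have hA : A = ∑ i, (A ∘ₗ tensorSingle 𝕜 i) ∘ₗ PiLp.projₗ 2 (fun _ => V) i := by
    ext1 t
    conv_lhs => rw [← sum_tensorSingle (𝕜 := 𝕜) t]
    simp only [map_sum, LinearMap.sum_apply]
    rfl
  conv_lhs => rw [hA, map_sum]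
  exact Finset.sum_congr rfl fun i _ => LinearMap.trace_comp_comm' _ _

end Blocks

section TraceTensor

variable {n : ℕ} {𝕜 : Type*} [RCLike 𝕜] {V : Type*} [NormedAddCommGroup V] [InnerProductSpace 𝕜 V]
  [Module ℝ V] [IsScalarTower ℝ 𝕜 V] (ρ : SO n →ₗ⁅ℝ⁆ Module.End 𝕜 V)

theorem tensorAction_tensorSingle (X : SO n) (i : Fin n) (v : V) :
    tensorAction ρ X (tensorSingle 𝕜 i v) =
      ∑ b, (X.1 b i : 𝕜) • tensorSingle 𝕜 b v + tensorSingle 𝕜 i (ρ X v) := by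
  ext k
  simp [tensorAction_apply, WithLp.ofLp_sum, Finset.sum_apply, tensorSingle_apply,
    apply_ite (ρ X)]

/-- The tensor `tr_V(A_{ai} ρ(e_j ∧ e_k))`. Contracting the normal and the connection form with it
gives the sum of the boundary integrands over an orthonormal basis of `V`. -/
noncomputable def traceTensor (A : RnTensor n V →ₗ[𝕜] RnTensor n V) (a i j k : Fin n) : 𝕜 :=
  LinearMap.trace 𝕜 V (blockOp A a i * rhoWedge ρ j k)

theorem traceTensor_skew (A : RnTensor n V →ₗ[𝕜] RnTensor n V) (a i j k : Fin n) :
    traceTensor ρ A a i j k = -traceTensor ρ A a i k j := by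
  rw [traceTensor, rhoWedge_swap, mul_neg, map_neg, traceTensor]

theorem sum_traceTensor_eq_trace [FiniteDimensional 𝕜 V] (A : RnTensor n V →ₗ[𝕜] RnTensor n V) :
    ∑ i, ∑ j, traceTensor ρ A i j j i = LinearMap.trace 𝕜 _ (A ∘ₗ confWeightLin ρ) := by
  have h (i : Fin n) : blockOp (A ∘ₗ confWeightLin ρ) i i =
      ∑ j, blockOp A i j * rhoWedge ρ j i := by
    ext v
    rw [blockOp_apply, LinearMap.comp_apply, apply_eq_sum_blockOp, LinearMap.sum_apply]
    refine Finset.sum_congr rfl fun j _ => ?_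
    change blockOp A i j (confWeightOp ρ _ j) = _
    simp [confWeightOp_apply, tensorSingle_apply, apply_ite (rhoWedge ρ _ _)]
  simp only [trace_eq_sum_trace_blockOp, h, map_sum, traceTensor]

theorem two_mul_massConstant_mul {ι : Type*} [Fintype ι] (hn : 2 ≤ n)
    (W : ι → Submodule 𝕜 (RnTensor n V)) (a : ι → ℝ) :
    2 * massConstant ρ W a * (n * ((n : ℝ) - 1)) =
      -∑ j, a j * (Module.finrank 𝕜 (W j) * confWeight ρ (W j)) := by
  have hn' : (2 : ℝ) ≤ n := by exact_mod_cast hn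
  have h0 : (n : ℝ) ≠ 0 := by positivity
  have h1 : (n : ℝ) - 1 ≠ 0 := by linarith
  rw [massConstant, mul_neg, neg_mul, Finset.mul_sum, Finset.sum_mul]
  congr 1
  refine Finset.sum_congr rfl fun j _ => ?_
  field_simp

theorem rhoConn_apply (G : Eucl n → Matrix (Fin n) (Fin n) ℝ) (v : V) (x : Eucl n) (i : Fin n) :
    rhoConn ρ G v x i =
      ∑ j, ∑ k, if j < k then (connCoeff G x i j k : 𝕜) • rhoWedge ρ j k v else 0 := by
  change ρ (connForm G x i) v = _
  simp only [connForm, map_sum, LinearMap.sum_apply, apply_ite ρ, map_smul, map_zero]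
  refine Finset.sum_congr rfl fun j _ => Finset.sum_congr rfl fun k _ => ?_
  split_ifs
  · rw [LinearMap.smul_apply, RCLike.real_smul_eq_coe_smul (K := 𝕜), rhoWedge]
  · rfl

variable {ρ} {A : RnTensor n V →ₗ[𝕜] RnTensor n V}

theorem blockOp_comm (hA : ∀ X t, A (tensorAction ρ X t) = tensorAction ρ X (A t)) (X : SO n)
    (a i : Fin n) :
    ∑ b, (X.1 b i : 𝕜) • blockOp A a b + blockOp A a i * ρ X =
      ρ X * blockOp A a i - ∑ b, (X.1 b a : 𝕜) • blockOp A b i := by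
  ext v
  have h := congrArg (fun t : RnTensor n V => t a) (hA X (tensorSingle 𝕜 i v))
  simp only [tensorAction_tensorSingle, map_add, map_sum, map_smul, tensorAction_apply,
    PiLp.add_apply, WithLp.ofLp_sum, Finset.sum_apply, PiLp.smul_apply, ← blockOp_apply] at h
  simp only [LinearMap.add_apply, LinearMap.sub_apply, LinearMap.sum_apply, LinearMap.smul_apply,
    Module.End.mul_apply, h, skew_apply X a, RCLike.ofReal_neg, neg_smul, Finset.sum_neg_distrib]
  abel

theorem traceTensor_invariant (hA : ∀ X t, A (tensorAction ρ X t) = tensorAction ρ X (A t))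
    (X : SO n) (a i j k : Fin n) :
    ∑ b, (X.1 b a : 𝕜) * traceTensor ρ A b i j k + ∑ b, (X.1 b i : 𝕜) * traceTensor ρ A a b j k +
      ∑ b, (X.1 b j : 𝕜) * traceTensor ρ A a i b k +
      ∑ b, (X.1 b k : 𝕜) * traceTensor ρ A a i j b = 0 := by
  have h := congrArg (fun F => LinearMap.trace 𝕜 V (F * rhoWedge ρ j k)) (blockOp_comm hA X a i)
  simp only [add_mul, sub_mul, Finset.sum_mul, smul_mul_assoc, map_add, map_sub, map_sum, map_smul,
    smul_eq_mul, mul_assoc, rho_mul_rhoWedge, mul_add, Finset.mul_sum, mul_smul_comm,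
    Finset.sum_add_distrib] at h
  rw [LinearMap.trace_mul_comm 𝕜 (ρ X), mul_assoc] at h
  simp only [traceTensor]
  linear_combination h

theorem isRotationInvariant_traceTensor
    (hA : ∀ X t, A (tensorAction ρ X t) = tensorAction ρ X (A t)) :
    IsRotationInvariant (traceTensor ρ A) := by
  intro p q a i j k
  have hwedge (f : Fin n → 𝕜) (l : Fin n) :
      ∑ b, ((wedge (stdVec p) (stdVec q)).1 b l : 𝕜) * f b =
        (if l = p then f q else 0) - if l = q then f p else 0 := by
    simp only [wedge_apply, stdVec_apply]
    by_cases hp : l = p <;> by_cases hq : l = q <;>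
      simp [hp, hq, sub_mul, Finset.sum_sub_distrib, apply_ite (RCLike.ofReal (K := 𝕜))]
  simpa only [hwedge] using traceTensor_invariant hA (wedge (stdVec p) (stdVec q)) a i j k

end TraceTensor

section WeightedProj

variable {n : ℕ} {𝕜 : Type*} [RCLike 𝕜] {V : Type*} [NormedAddCommGroup V] [InnerProductSpace 𝕜 V]
  [FiniteDimensional 𝕜 V] {ι : Type*} [Fintype ι] {W : ι → Submodule 𝕜 (RnTensor n V)}

/-- The operator `weightedProj W a` as a linear map. -/
noncomputable def weightedProjLin (W : ι → Submodule 𝕜 (RnTensor n V)) (a : ι → ℝ) :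
    RnTensor n V →ₗ[𝕜] RnTensor n V :=
  ∑ j, (a j : 𝕜) • ((W j).starProjection : RnTensor n V →ₗ[𝕜] RnTensor n V)

theorem weightedProjLin_apply (a : ι → ℝ) (t : RnTensor n V) :
    weightedProjLin W a t = weightedProj W a t := by
  simp [weightedProjLin, weightedProj, LinearMap.sum_apply]

variable [Module ℝ V] [IsScalarTower ℝ 𝕜 V] {ρ : SO n →ₗ⁅ℝ⁆ Module.End 𝕜 V}

theorem weightedProjLin_tensorAction
    (hρ : ∀ X v w, inner 𝕜 (ρ X v) w = -inner 𝕜 v (ρ X w))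
    (hW : ∀ j X, ∀ t ∈ W j, tensorAction ρ X t ∈ W j) (a : ι → ℝ) (X : SO n)
    (t : RnTensor n V) :
    weightedProjLin W a (tensorAction ρ X t) = tensorAction ρ X (weightedProjLin W a t) := by
  have hproj (j : ι) : (W j).starProjection (tensorAction ρ X t) =
      tensorActionLin ρ X ((W j).starProjection t) :=
    starProjection_map_of_invariant (S := tensorActionLin ρ X) (S' := -tensorActionLin ρ X)
      (fun s t => by
        rw [LinearMap.neg_apply, inner_neg_left, neg_eq_iff_eq_neg]
        exact tensorAction_skew hρ X s t)
      (hW j X) (fun t ht => (W j).neg_mem (hW j X t ht)) t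
  change _ = tensorActionLin ρ X _
  simp only [weightedProjLin_apply, weightedProj, map_sum, map_smul, hproj]

theorem trace_weightedProjLin_comp_confWeightLin (hρ : IsIrreducibleOrthogonal ρ)
    (hW : ∀ j, IsIrreducibleSubspace (tensorAction ρ) (W j)) (a : ι → ℝ) :
    LinearMap.trace 𝕜 _ (weightedProjLin W a ∘ₗ confWeightLin ρ) =
      ((∑ j, a j * (Module.finrank 𝕜 (W j) * confWeight ρ (W j)) : ℝ) : 𝕜) := by
  have hw (j : ι) (t : RnTensor n V) (ht : t ∈ W j) :
      confWeightLin ρ t = (confWeight ρ (W j) : 𝕜) • t :=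
    hρ.confWeightOp_eq_confWeight_smul (hW j) ht
  have hmem (j : ι) (t : RnTensor n V) (ht : t ∈ W j) : confWeightLin ρ t ∈ W j := by
    rw [hw j t ht]
    exact (W j).smul_mem _ ht
  have hproj (j : ι) (t : RnTensor n V) : (W j).starProjection (confWeightLin ρ t) =
      (confWeight ρ (W j) : 𝕜) • (W j).starProjection t := by
    rw [starProjection_map_of_invariant (confWeightLin_isSymmetric hρ.skew) (hmem j) (hmem j),
      hw j _ ((W j).starProjection_apply_mem t)]
  have hcomp : weightedProjLin W a ∘ₗ confWeightLin ρ = ∑ j, ((a j : 𝕜) * confWeight ρ (W j)) •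
      ((W j).starProjection : RnTensor n V →ₗ[𝕜] RnTensor n V) := by
    ext1 t
    simp only [weightedProjLin, LinearMap.comp_apply, LinearMap.sum_apply, LinearMap.smul_apply,
      ContinuousLinearMap.coe_coe, hproj, smul_smul]
  have htrace (j : ι) : LinearMap.trace 𝕜 _
      ((W j).starProjection : RnTensor n V →ₗ[𝕜] RnTensor n V) = Module.finrank 𝕜 (W j) :=
    LinearMap.IsProj.trace ⟨(W j).starProjection_apply_mem,
      fun t ht => Submodule.starProjection_eq_self_iff.2 ht⟩
  simp only [hcomp, map_sum, map_smul, htrace, smul_eq_mul, RCLike.ofReal_mul,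
    RCLike.ofReal_natCast, mul_assoc, mul_comm (confWeight ρ _ : 𝕜)]

/-- By invariance the symmetrization is a multiple of `massTensor`; the multiple is found by taking
the trace of `A ∘ B`, with `B` the conformal weight operator. -/
theorem traceTensor_add_swap_eq (hn : 3 ≤ n) (hρ : IsIrreducibleOrthogonal ρ)
    (hW : ∀ j, IsIrreducibleSubspace (tensorAction ρ) (W j)) (α : ι → ℝ) (a i j k : Fin n) :
    traceTensor ρ (weightedProjLin W α) a i j k + traceTensor ρ (weightedProjLin W α) a k j i =
      ((2 * massConstant ρ W α : ℝ) : 𝕜) * massTensor 𝕜 a i j k := by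
  have hskew := traceTensor_skew ρ (weightedProjLin W α)
  obtain ⟨c, hc⟩ := (isRotationInvariant_traceTensor (weightedProjLin_tensorAction hρ.skew
    (fun j => (hW j).invariant) α)).exists_add_swap_eq_mul_massTensor (by simpa using hn) hskew
  have hsum := sum_apply_eq_of_add_swap_eq hskew hc
  rw [sum_traceTensor_eq_trace, trace_weightedProjLin_comp_confWeightLin hρ hW, Fintype.card_fin,
    ← neg_neg (∑ j, α j * _), ← two_mul_massConstant_mul ρ (by lia), RCLike.ofReal_neg] at hsum
  have hn0 : (n : 𝕜) ≠ 0 := by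
    have : n ≠ 0 := by lia
    exact_mod_cast this
  have hn1 : (n : 𝕜) - 1 ≠ 0 := by
    have : n ≠ 1 := by lia
    exact sub_ne_zero.2 (by exact_mod_cast this)
  have hcm : ((2 * massConstant ρ W α : ℝ) : 𝕜) = c := by
    apply mul_right_cancel₀ (mul_ne_zero hn0 hn1)
    push_cast at hsum ⊢
    linear_combination -hsum
  rw [hc, hcm]

theorem sum_inner_pureTensor_rhoConn (α : ι → ℝ) (G : Eucl n → Matrix (Fin n) (Fin n) ℝ)
    {κ : Type*} [Fintype κ] (σ : OrthonormalBasis κ 𝕜 V) (x ν : Eucl n) :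
    ∑ l, inner 𝕜 (pureTensor 𝕜 ν (σ l)) (weightedProj W α (rhoConn ρ G (σ l) x)) =
      ∑ a, (ν a : 𝕜) * formContraction (traceTensor ρ (weightedProjLin W α))
        (fun i j k => (connCoeff G x i j k : 𝕜)) a := by
  simp only [PiLp.inner_apply, ← weightedProjLin_apply, apply_eq_sum_blockOp, rhoConn_apply]
  rw [Finset.sum_comm]
  refine Finset.sum_congr rfl fun a _ => ?_
  simp only [formContraction, traceTensor, LinearMap.trace_eq_sum_inner _ σ, pureTensor,
    inner_smul_left, RCLike.conj_ofReal, map_sum, inner_sum,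
    apply_ite (blockOp _ _ _), map_zero, map_smul, Module.End.mul_apply, apply_ite (inner 𝕜 _),
    inner_smul_right, inner_zero_right]
  rw [Finset.sum_comm, Finset.mul_sum]
  refine Finset.sum_congr rfl fun i _ => ?_
  rw [Finset.sum_comm, Finset.mul_sum]
  refine Finset.sum_congr rfl fun j _ => ?_
  rw [Finset.sum_comm, Finset.mul_sum]
  refine Finset.sum_congr rfl fun k _ => ?_
  split_ifs
  · simp only [Finset.mul_sum, mul_left_comm]
  · simp only [Finset.sum_const_zero, mul_zero]

end WeightedProj

/-! ### Integration over spheres -/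

section UnitSphere

variable {E : Type*} [NormedAddCommGroup E]

theorem exists_forall_of_eventually_cobounded {P : E → Prop} (h : ∀ᶠ x in cobounded E, P x) :
    ∃ R, 0 ≤ R ∧ ∀ x, R < ‖x‖ → P x := by
  rw [← comap_norm_atTop, eventually_comap] at h
  obtain ⟨R, hR⟩ := eventually_atTop.1 h
  exact ⟨max R 0, le_max_right _ _, fun x hx => hR _ ((le_max_left _ _).trans hx.le) x rfl⟩

variable [NormedSpace ℝ E]

theorem norm_smul_sphere (r : ℝ) (ν : sphere (0 : E) 1) : ‖r • (ν : E)‖ = |r| := by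
  simp [norm_smul]

theorem eventually_forall_smul_sphere {P : E → Prop} (h : ∀ᶠ x in cobounded E, P x) :
    ∀ᶠ r : ℝ in atTop, ∀ ν : sphere (0 : E) 1, P (r • (ν : E)) := by
  obtain ⟨R, -, hR⟩ := exists_forall_of_eventually_cobounded h
  filter_upwards [eventually_gt_atTop R] with r hr ν
  exact hR _ (by simpa only [norm_smul_sphere] using hr.trans_le (le_abs_self r))

end UnitSphere

theorem hasDerivAt_integral_of_continuousOn {X F : Type*} [TopologicalSpace X] [CompactSpace X]
    [MeasurableSpace X] [OpensMeasurableSpace X] [NormedAddCommGroup F] [NormedSpace ℝ F]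
    {μ : Measure X} [IsFiniteMeasure μ] {f f' : ℝ → X → F} {s : Set ℝ} (hs : IsOpen s)
    (hf : ∀ t ∈ s, Continuous (f t)) (hf' : ContinuousOn (Function.uncurry f') (s ×ˢ Set.univ))
    (hderiv : ∀ t ∈ s, ∀ x, HasDerivAt (fun t => f t x) (f' t x) t) {t : ℝ} (ht : t ∈ s) :
    HasDerivAt (fun t => ∫ x, f t x ∂μ) (∫ x, f' t x ∂μ) t := by
  have integrable {g : X → F} (hg : Continuous g) : Integrable g μ :=
    hg.integrable_of_hasCompactSupport (HasCompactSupport.of_compactSpace g)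
  have hf't : Continuous (f' t) :=
    hf'.comp_continuous (by fun_prop : Continuous fun x => (t, x)) fun _ => ⟨ht, trivial⟩
  obtain ⟨ε, hε, hball⟩ := Metric.nhds_basis_closedBall.mem_iff.1 (hs.mem_nhds ht)
  obtain ⟨C, hC⟩ := ((isCompact_closedBall t ε).prod isCompact_univ).exists_bound_of_continuousOn
    (hf'.mono (Set.prod_mono hball subset_rfl))
  refine (hasDerivAt_integral_of_dominated_loc_of_deriv_le (bound := fun _ => C)
    (closedBall_mem_nhds t hε) ?_ (integrable (hf t ht)) (integrable hf't).aestronglyMeasurable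
    (ae_of_all _ fun x u hu => hC (u, x) ⟨hu, trivial⟩) (integrable_const _)
    (ae_of_all _ fun x u hu => hderiv u (hball hu) x)).2
  filter_upwards [hs.mem_nhds ht] with u hu
  exact (integrable (hf u hu)).aestronglyMeasurable

section Rotations

variable {E : Type*} [NormedAddCommGroup E] [InnerProductSpace ℝ E]

/-- The action of a linear isometry on the unit sphere. -/
def sphereMap (L : E ≃ₗᵢ[ℝ] E) (ν : sphere (0 : E) 1) : sphere (0 : E) 1 := ⟨L ν, by simp⟩

theorem continuous_sphereMap (L : E ≃ₗᵢ[ℝ] E) : Continuous (sphereMap L) :=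
  (L.continuous.comp continuous_subtype_val).subtype_mk _

variable [FiniteDimensional ℝ E]

theorem exists_linearIsometryEquiv_eq_exp {A : E →L[ℝ] E}
    (hA : ∀ x y, inner ℝ (A x) y = -inner ℝ x (A y)) (t : ℝ) :
    ∃ L : E ≃ₗᵢ[ℝ] E, ∀ x, L x = NormedSpace.exp (t • A) x := by
  let +nondep : NormedAlgebra ℚ (E →L[ℝ] E) := .restrictScalars ℚ ℝ _
  have hskew : A ∈ skewAdjoint (E →L[ℝ] E) := by
    rw [skewAdjoint.mem_iff, eq_comm, ContinuousLinearMap.star_eq_adjoint,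
      ContinuousLinearMap.eq_adjoint_iff]
    intro x y
    rw [neg_apply, inner_neg_left, hA, neg_neg]
  exact ⟨Unitary.linearIsometryEquiv ⟨_, NormedSpace.exp_mem_unitary_of_mem_skewAdjoint
    (skewAdjoint.smul_mem t hskew)⟩, fun _ => rfl⟩

variable [MeasurableSpace E] [BorelSpace E]

theorem measurePreserving_sphereMap (L : E ≃ₗᵢ[ℝ] E) :
    MeasurePreserving (sphereMap L) (volume : Measure E).toSphere
      (volume : Measure E).toSphere := by
  have hmeas := (continuous_sphereMap L).measurable
  refine ⟨hmeas, Measure.ext fun s hs => ?_⟩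
  rw [Measure.map_apply hmeas hs, Measure.toSphere_apply' _ hs,
    Measure.toSphere_apply' _ (hmeas hs),
    ← L.symm.measurePreserving.measure_preimage_emb L.symm.toHomeomorph.measurableEmbedding]
  congr 2
  ext x
  simp only [Set.mem_smul, Set.mem_image, Set.mem_preimage]
  constructor
  · rintro ⟨r, hr, _, ⟨ν, hν, rfl⟩, hx⟩
    refine ⟨r, hr, _, ⟨sphereMap L ν, hν, rfl⟩, L.symm.injective ?_⟩
    rw [← hx]
    simp [sphereMap]
  · rintro ⟨r, hr, _, ⟨ν, hν, rfl⟩, rfl⟩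
    have hinv : sphereMap L (sphereMap L.symm ν) = ν := Subtype.ext (by simp [sphereMap])
    exact ⟨r, hr, _, ⟨sphereMap L.symm ν, by rwa [hinv], rfl⟩, by simp [sphereMap]⟩

theorem integral_sphereMap {F : Type*} [NormedAddCommGroup F] [NormedSpace ℝ F] (L : E ≃ₗᵢ[ℝ] E)
    (f : E → F) :
    ∫ ν : sphere (0 : E) 1, f (L ν) ∂(volume : Measure E).toSphere =
      ∫ ν : sphere (0 : E) 1, f ν ∂(volume : Measure E).toSphere :=
  (measurePreserving_sphereMap L).integral_comp ((continuous_sphereMap L).isClosedEmbedding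
    fun _ _ h => Subtype.ext (L.injective (congrArg Subtype.val h))).measurableEmbedding
    fun ν => f ν

/-- The rotations `exp (t A)` preserve the integral of `f` over the sphere of radius `r`;
differentiate at `t = 0`. -/
theorem integral_fderiv_skew_eq_zero {A : E →L[ℝ] E}
    (hA : ∀ x y, inner ℝ (A x) y = -inner ℝ x (A y)) {f : E → ℝ} {r : ℝ}
    (hf : ∀ ν : sphere (0 : E) 1, ContDiffAt ℝ 1 f (r • (ν : E))) :
    ∫ ν : sphere (0 : E) 1, fderiv ℝ f (r • (ν : E)) (A (r • (ν : E)))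
      ∂(volume : Measure E).toSphere = 0 := by
  choose L hL using exists_linearIsometryEquiv_eq_exp hA
  have hfL (t : ℝ) (ν : sphere (0 : E) 1) : ContDiffAt ℝ 1 f (r • L t ν) :=
    hf (sphereMap (L t) ν)
  have hLderiv (t : ℝ) (x : E) : HasDerivAt (fun t => L t x) (A (L t x)) t := by
    simp only [hL]
    exact (hasDerivAt_exp_smul_const' A t).clm_apply (hasDerivAt_const t x) |>.congr_deriv
      (by simp)
  have hLcont : Continuous fun p : ℝ × sphere (0 : E) 1 => L p.1 p.2 := by
    let +nondep : NormedAlgebra ℚ (E →L[ℝ] E) := .restrictScalars ℚ ℝ _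
    simp only [hL]
    exact (NormedSpace.exp_continuous.comp (by fun_prop)).clm_apply (by fun_prop)
  have hcont : Continuous fun p : ℝ × sphere (0 : E) 1 => fderiv ℝ f (r • L p.1 p.2) :=
    continuous_iff_continuousAt.2 fun p => ((hfL p.1 p.2).continuousAt_fderiv one_ne_zero).comp
      (f := fun p : ℝ × sphere (0 : E) 1 => r • L p.1 p.2) (hLcont.const_smul r).continuousAt
  have hderiv := hasDerivAt_integral_of_continuousOn (μ := (volume : Measure E).toSphere)
    (f := fun t ν => f (r • L t ν)) (f' := fun t ν => fderiv ℝ f (r • L t ν) (A (r • L t ν)))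
    isOpen_univ
    (fun t _ => continuous_iff_continuousAt.2 fun ν => (hfL t ν).continuousAt.comp
      (f := fun ν : sphere (0 : E) 1 => r • L t ν) (by fun_prop))
    (hcont.clm_apply (A.continuous.comp (hLcont.const_smul r))).continuousOn
    (fun t _ ν => by
      rw [map_smul]
      exact ((hfL t ν).differentiableAt one_ne_zero).hasFDerivAt.comp_hasDerivAt t
        ((hLderiv t ν).const_smul r))
    (Set.mem_univ 0)
  have hinvariant (t : ℝ) := integral_sphereMap (L t) fun x => f (r • x)
  have hL0 (x : E) : L 0 x = x := by simp [hL]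
  simp only [hinvariant, hL0] at hderiv
  exact hderiv.unique (hasDerivAt_const _ _)

end Rotations

/-! ### The divergence theorem on large spheres -/

section SphericalDivergence

variable {E : Type*} [NormedAddCommGroup E] [InnerProductSpace ℝ E]

/-- The infinitesimal rotation `x ↦ ⟨u, x⟩ v - ⟨v, x⟩ u`. -/
noncomputable def rotationGenerator (u v : E) : E →L[ℝ] E :=
  (innerSL ℝ u).smulRight v - (innerSL ℝ v).smulRight u

theorem rotationGenerator_apply (u v x : E) :
    rotationGenerator u v x = inner ℝ u x • v - inner ℝ v x • u := rfl

theorem inner_rotationGenerator (u v x y : E) :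
    inner ℝ (rotationGenerator u v x) y = -inner ℝ x (rotationGenerator u v y) := by
  simp only [rotationGenerator_apply, inner_sub_left, inner_sub_right, real_inner_smul_left,
    real_inner_smul_right, real_inner_comm u x, real_inner_comm v x]
  ring

theorem sum_fderiv_inner_mul_rotationGenerator {ι : Type*} [Fintype ι]
    (b : OrthonormalBasis ι ℝ E) {f : E → ℝ} {x : E} (hf : DifferentiableAt ℝ f x) (u : E) :
    ∑ i, fderiv ℝ (fun y => inner ℝ (b i) y * f y) x (rotationGenerator (b i) u x) =
      ‖x‖ ^ 2 * fderiv ℝ f x u - inner ℝ u x * fderiv ℝ f x x -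
        (Fintype.card ι - 1) * (inner ℝ u x * f x) := by
  have hterm (i : ι) : fderiv ℝ (fun y => inner ℝ (b i) y * f y) x (rotationGenerator (b i) u x) =
      inner ℝ x (b i) * inner ℝ (b i) x * fderiv ℝ f x u -
        inner ℝ u x * (inner ℝ (b i) x * fderiv ℝ f x (b i)) +
        f x * (inner ℝ u (b i) * inner ℝ (b i) x) - inner ℝ u x * f x := by
    have hinner : HasFDerivAt (fun y => inner ℝ (b i) y) (innerSL ℝ (b i)) x :=
      (innerSL ℝ (b i)).hasFDerivAt
    rw [(hinner.fun_mul hf.hasFDerivAt).fderiv]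
    simp only [rotationGenerator_apply, add_apply, smul_apply,
      innerSL_apply_apply, map_sub, map_smul, smul_eq_mul, real_inner_self_eq_norm_sq,
      b.norm_eq_one, real_inner_comm u (b i), real_inner_comm x (b i)]
    ring
  have hfderiv : ∑ i, inner ℝ (b i) x * fderiv ℝ f x (b i) = fderiv ℝ f x x := by
    simpa only [map_sum, map_smul, smul_eq_mul] using congrArg (fderiv ℝ f x) (b.sum_repr' x)
  simp only [hterm, Finset.sum_sub_distrib, Finset.sum_add_distrib, ← Finset.sum_mul,
    ← Finset.mul_sum, b.sum_inner_mul_inner, hfderiv, real_inner_self_eq_norm_sq,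
    Finset.sum_const, Finset.card_univ, nsmul_eq_mul]
  ring

variable [FiniteDimensional ℝ E] [MeasurableSpace E] [BorelSpace E]

theorem integrable_toSphere {F : Type*} [NormedAddCommGroup F] {g : sphere (0 : E) 1 → F}
    (hg : Continuous g) : Integrable g (volume : Measure E).toSphere :=
  hg.integrable_of_hasCompactSupport (HasCompactSupport.of_compactSpace g)

omit [FiniteDimensional ℝ E] [MeasurableSpace E] [BorelSpace E] in
theorem continuous_comp_smul_sphere {F : Type*} [TopologicalSpace F] {g : E → F} {r : ℝ}
    (hg : ∀ ν : sphere (0 : E) 1, ContinuousAt g (r • (ν : E))) :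
    Continuous fun ν : sphere (0 : E) 1 => g (r • (ν : E)) :=
  continuous_iff_continuousAt.2 fun ν => (hg ν).comp
    (f := fun ν : sphere (0 : E) 1 => r • (ν : E)) (by fun_prop)

/-- Integrate the derivatives of `⟪b i, x⟫ f x` along the rotations in the planes spanned by `u`
and the vectors `b i` of an orthonormal basis. -/
theorem integral_fderiv_sphere {f : E → ℝ} {r : ℝ} (hr : r ≠ 0)
    (hf : ∀ ν : sphere (0 : E) 1, ContDiffAt ℝ 1 f (r • (ν : E))) (u : E) :
    r * ∫ ν : sphere (0 : E) 1, fderiv ℝ f (r • (ν : E)) u ∂(volume : Measure E).toSphere =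
      r * ∫ ν : sphere (0 : E) 1, fderiv ℝ f (r • (ν : E)) ν * inner ℝ u (ν : E)
          ∂(volume : Measure E).toSphere +
        (Module.finrank ℝ E - 1) * ∫ ν : sphere (0 : E) 1, f (r • (ν : E)) * inner ℝ u (ν : E)
          ∂(volume : Measure E).toSphere := by
  have hcont := continuous_comp_smul_sphere fun ν => (hf ν).continuousAt
  have hcont' := continuous_comp_smul_sphere fun ν => (hf ν).continuousAt_fderiv one_ne_zero
  set b := stdOrthonormalBasis ℝ E
  have hprod (i) (ν : sphere (0 : E) 1) :
      ContDiffAt ℝ 1 (fun y => inner ℝ (b i) y * f y) (r • (ν : E)) :=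
    (innerSL ℝ (b i)).contDiff.contDiffAt.mul (hf ν)
  have hrotation (i) := integral_fderiv_skew_eq_zero (inner_rotationGenerator (b i) u) (hprod i)
  have hpointwise (ν : sphere (0 : E) 1) :
      ∑ i, fderiv ℝ (fun y => inner ℝ (b i) y * f y) (r • (ν : E))
          (rotationGenerator (b i) u (r • (ν : E))) =
        r * (r * fderiv ℝ f (r • (ν : E)) u -
          r * (fderiv ℝ f (r • (ν : E)) ν * inner ℝ u (ν : E)) -
          (Module.finrank ℝ E - 1) * (f (r • (ν : E)) * inner ℝ u (ν : E))) := by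
    rw [sum_fderiv_inner_mul_rotationGenerator b ((hf ν).differentiableAt one_ne_zero),
      norm_smul_sphere, sq_abs, Fintype.card_fin, map_smul, smul_eq_mul, real_inner_smul_right]
    ring
  have hsum := Finset.sum_eq_zero fun i (_ : i ∈ Finset.univ) => hrotation i
  rw [← integral_finsetSum _ fun i _ => integrable_toSphere
    ((continuous_comp_smul_sphere fun ν => (hprod i ν).continuousAt_fderiv one_ne_zero).clm_apply
      (by fun_prop))] at hsum
  simp only [hpointwise] at hsum
  rw [integral_const_mul, integral_sub, integral_sub, integral_const_mul, integral_const_mul,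
    integral_const_mul] at hsum
  · linear_combination (mul_eq_zero.1 hsum).resolve_left hr
  · exact integrable_toSphere (by fun_prop)
  · exact integrable_toSphere (by fun_prop)
  · exact integrable_toSphere (by fun_prop)
  · exact integrable_toSphere ((hcont.mul (by fun_prop)).const_mul _)

end SphericalDivergence

section Flux

variable {n : ℕ}

theorem hasDerivAt_sphereIntegral_mul {R r : ℝ} (hR : 0 ≤ R) (hr : R < r) {f : Eucl n → ℝ}
    (hf : ∀ x, R < ‖x‖ → ContDiffAt ℝ 1 f x) (k : Fin n) :
    HasDerivAt (sphereIntegral fun x ν => f x * ν k)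
      (sphereIntegral (fun x _ => pd k f x) r) r := by
  have hr0 : 0 < r := hR.trans_lt hr
  have hf' {t : ℝ} (ht : R < t) (ν : sphere (0 : Eucl n) 1) : ContDiffAt ℝ 1 f (t • (ν : Eucl n)) :=
    hf _ (by simpa only [norm_smul_sphere] using ht.trans_le (le_abs_self t))
  have hray := hasDerivAt_integral_of_continuousOn (μ := (volume : Measure (Eucl n)).toSphere)
    (f := fun t ν => f (t • (ν : Eucl n)) * (ν : Eucl n) k)
    (f' := fun t ν => fderiv ℝ f (t • (ν : Eucl n)) ν * (ν : Eucl n) k) (isOpen_Ioi (a := R))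
    (fun t ht => (continuous_comp_smul_sphere fun ν => (hf' ht ν).continuousAt).mul (by fun_prop))
    (fun p hp => (ContinuousAt.mul (ContinuousAt.clm_apply
      (((hf' hp.1 p.2).continuousAt_fderiv one_ne_zero).comp
        (f := fun p : ℝ × sphere (0 : Eucl n) 1 => p.1 • (p.2 : Eucl n)) (by fun_prop))
      (by fun_prop)) (by fun_prop)).continuousWithinAt)
    (fun t ht ν => (((hf' ht ν).differentiableAt one_ne_zero).hasFDerivAt.comp_hasDerivAt t
      (by simpa using (hasDerivAt_id t).smul_const (ν : Eucl n))).mul_const _) hr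
  have hdivergence := integral_fderiv_sphere hr0.ne' (hf' hr) (stdVec k)
  have hinner (ν : Eucl n) : inner ℝ (stdVec k) ν = ν k := by
    simp [stdVec, EuclideanSpace.inner_single_left]
  refine ((hasDerivAt_pow (n - 1) r).mul hray).congr_deriv (mul_left_cancel₀ hr0.ne' ?_)
  obtain ⟨m, rfl⟩ : ∃ m, n = m + 1 := Nat.exists_eq_add_one.2 k.pos
  have hpow : (m : ℝ) * r ^ (m - 1) * r = m * r ^ m := by
    rcases m with _ | m
    · simp
    · rw [Nat.add_sub_cancel, pow_succ, mul_assoc]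
  simp only [hinner, finrank_euclideanSpace_fin, Nat.cast_add, Nat.cast_one,
    add_sub_cancel_right] at hdivergence ⊢
  simp only [sphereIntegral, pd, smul_eq_mul, Nat.add_sub_cancel]
  linear_combination -r ^ m * hdivergence + hpow * ∫ ν : sphere (0 : Eucl (m + 1)) 1,
    f (r • (ν : Eucl (m + 1))) * (ν : Eucl (m + 1)) k ∂(volume : Measure (Eucl (m + 1))).toSphere

end Flux

section FluxLimit

variable {n : ℕ}

theorem sphereIntegral_finsetSum {ι F : Type*} [NormedAddCommGroup F] [NormedSpace ℝ F]
    {f : ι → Eucl n → Eucl n → F} {r : ℝ} (s : Finset ι)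
    (hf : ∀ i ∈ s, Continuous fun ν : sphere (0 : Eucl n) 1 => f i (r • (ν : Eucl n)) ν) :
    sphereIntegral (fun x ν => ∑ i ∈ s, f i x ν) r = ∑ i ∈ s, sphereIntegral (f i) r := by
  simp only [sphereIntegral, ← Finset.smul_sum]
  rw [integral_finsetSum _ fun i hi => integrable_toSphere (hf i hi)]

theorem hasDerivAt_flux {R r : ℝ} (hR : 0 ≤ R) (hr : R < r) {F : Fin n → Eucl n → ℝ}
    (hF : ∀ x, R < ‖x‖ → ∀ k, ContDiffAt ℝ 1 (F k) x) :
    HasDerivAt (sphereIntegral fun x ν => ∑ k, F k x * ν k)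
      (sphereIntegral (fun x _ => ∑ k, pd k (F k) x) r) r := by
  have hF' {t : ℝ} (ht : R < t) (ν : sphere (0 : Eucl n) 1) (k) :
      ContDiffAt ℝ 1 (F k) (t • (ν : Eucl n)) :=
    hF _ (by simpa only [norm_smul_sphere] using ht.trans_le (le_abs_self t)) k
  have hsum := HasDerivAt.fun_sum fun k (_ : k ∈ Finset.univ) =>
    hasDerivAt_sphereIntegral_mul hR hr (fun x hx => hF x hx k) k
  refine (hsum.congr_of_eventuallyEq ?_).congr_deriv ?_
  · filter_upwards [Ioi_mem_nhds hr] with t ht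
    exact sphereIntegral_finsetSum _ fun k _ =>
      (continuous_comp_smul_sphere fun ν => (hF' ht ν k).continuousAt).mul (by fun_prop)
  · exact (sphereIntegral_finsetSum _ fun k _ => (continuous_comp_smul_sphere fun ν =>
      (hF' hr ν k).continuousAt_fderiv one_ne_zero).clm_apply continuous_const).symm

theorem integrableOn_sphereIntegral [NeZero n] {R : ℝ} (hR : 0 ≤ R) {f : Eucl n → ℝ}
    (hf : IntegrableOn f {x | R < ‖x‖}) :
    IntegrableOn (sphereIntegral fun x _ => f x) (Set.Ioi R) := by
  set g : Eucl n → ℝ := {x | R < ‖x‖}.indicator f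
  have hg : Integrable g := (integrable_indicator_iff
    (isOpen_lt continuous_const continuous_norm).measurableSet).2 hf
  have hpolar : Integrable (fun p : sphere (0 : Eucl n) 1 × Set.Ioi (0 : ℝ) =>
      g ((p.2 : ℝ) • (p.1 : Eucl n))) ((volume : Measure (Eucl n)).toSphere.prod
        (.volumeIoiPow (Module.finrank ℝ (Eucl n) - 1))) := by
    rw [← (volume : Measure (Eucl n)).measurePreserving_homeomorphUnitSphereProd.integrable_comp_emb
      (Homeomorph.measurableEmbedding _)]
    refine ((integrableOn_iff_comap_subtypeVal (measurableSet_singleton (0 : Eucl n)).compl).1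
      hg.integrableOn).congr (ae_of_all _ fun x => ?_)
    simp only [Function.comp_apply, homeomorphUnitSphereProd_apply_snd_coe,
      homeomorphUnitSphereProd_apply_fst_coe]
    rw [smul_inv_smul₀ (norm_ne_zero_iff.2 x.2)]
  have hradial := hpolar.integral_prod_right
  rw [Measure.volumeIoiPow, integrable_withDensity_iff_integrable_smul' (by fun_prop)
    (by simp)] at hradial
  have hIoi : IntegrableOn (fun r : ℝ => (ENNReal.ofReal (r ^ (n - 1))).toReal •
      ∫ ν : sphere (0 : Eucl n) 1, g (r • (ν : Eucl n))
        ∂(volume : Measure (Eucl n)).toSphere) (Set.Ioi 0) := by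
    rw [integrableOn_iff_comap_subtypeVal measurableSet_Ioi]
    simpa [Function.comp_def] using hradial
  refine (hIoi.mono_set (Set.Ioi_subset_Ioi hR)).congr_fun (fun r hr => ?_) measurableSet_Ioi
  have hr0 : 0 ≤ r := hR.trans hr.le
  have hgf (ν : sphere (0 : Eucl n) 1) : g (r • (ν : Eucl n)) = f (r • (ν : Eucl n)) :=
    Set.indicator_of_mem (by simpa [norm_smul, abs_of_nonneg hr0] using hr) f
  simp only [sphereIntegral, hgf, ENNReal.toReal_ofReal (pow_nonneg hr0 _)]

theorem exists_integrableOn_of_integrableAtFilter_cobounded {f : Eucl n → ℝ}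
    (hf : IntegrableAtFilter f (cobounded (Eucl n))) : ∃ R, IntegrableOn f {x | R < ‖x‖} := by
  obtain ⟨s, hs, hfs⟩ := hf
  obtain ⟨R, -, hR⟩ := exists_forall_of_eventually_cobounded hs
  exact ⟨R, hfs.mono_set hR⟩

theorem tendsto_flux [NeZero n] {F : Fin n → Eucl n → ℝ}
    (hF : ∀ᶠ x in cobounded (Eucl n), ∀ k, ContDiffAt ℝ 1 (F k) x)
    (hdiv : IntegrableAtFilter (fun x => ∑ k, pd k (F k) x) (cobounded (Eucl n))) :
    Tendsto (sphereIntegral fun x ν => ∑ k, F k x * ν k) atTop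
      (𝓝 (limUnder atTop (sphereIntegral fun x ν => ∑ k, F k x * ν k))) := by
  obtain ⟨R₁, hR₁, hF⟩ := exists_forall_of_eventually_cobounded hF
  obtain ⟨R₂, hdiv⟩ := exists_integrableOn_of_integrableAtFilter_cobounded hdiv
  exact tendsto_limUnder_of_hasDerivAt_of_integrableOn_Ioi (a := max R₁ R₂)
    (fun r hr => hasDerivAt_flux hR₁ ((le_max_left _ _).trans_lt hr) hF)
    (integrableOn_sphereIntegral (hR₁.trans (le_max_left _ _))
      (hdiv.mono_set fun x hx => (le_max_right R₁ R₂).trans_lt hx))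

theorem tendsto_sphereIntegral_zero {F : Type*} [NormedAddCommGroup F] [NormedSpace ℝ F]
    {f : Eucl n → Eucl n → F} {C s : ℝ} (hs : s + ((n - 1 : ℕ) : ℝ) < 0)
    (hf : ∀ᶠ x in cobounded (Eucl n), ∀ ν ∈ sphere (0 : Eucl n) 1, ‖f x ν‖ ≤ C * ‖x‖ ^ s) :
    Tendsto (sphereIntegral f) atTop (𝓝 0) := by
  set m := (volume : Measure (Eucl n)).toSphere.real Set.univ
  have hlim : Tendsto (fun r : ℝ => C * m * r ^ (s + ((n - 1 : ℕ) : ℝ))) atTop (𝓝 0) := by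
    simpa using (tendsto_rpow_neg_atTop (neg_pos.2 hs)).const_mul (C * m)
  refine squeeze_zero_norm' ?_ hlim
  filter_upwards [eventually_forall_smul_sphere hf, eventually_gt_atTop 0] with r hbound hr
  have hintegral : ‖∫ ν : sphere (0 : Eucl n) 1, f (r • (ν : Eucl n)) ν
      ∂(volume : Measure (Eucl n)).toSphere‖ ≤ C * r ^ s * m :=
    norm_integral_le_of_norm_le_const (ae_of_all _ fun ν => by
      simpa [norm_smul, abs_of_pos hr] using hbound ν ν ν.2)
  rw [sphereIntegral, norm_smul, Real.norm_of_nonneg (by positivity)]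
  calc r ^ (n - 1) * _ ≤ r ^ (n - 1) * (C * r ^ s * m) := by gcongr
    _ = C * m * r ^ (s + ((n - 1 : ℕ) : ℝ)) := by
      rw [Real.rpow_add hr, Real.rpow_natCast]
      ring

end FluxLimit

/-! ### Decay at infinity -/

section Decay

variable {E F : Type*} [NormedAddCommGroup E]

theorem eventually_cobounded_nhds {P : E → Prop} (h : ∀ᶠ x in cobounded E, P x) :
    ∀ᶠ x in cobounded E, ∀ᶠ y in 𝓝 x, P y := by
  obtain ⟨R, -, hR⟩ := exists_forall_of_eventually_cobounded h
  filter_upwards [tendsto_norm_cobounded_atTop.eventually_gt_atTop R] with x hx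
  filter_upwards [(isOpen_lt continuous_const continuous_norm).mem_nhds hx] with y hy
  exact hR y hy

/-- `IsBigORpow f s` says that `f` is `O(‖x‖ ^ s)` as `x` tends to infinity. -/
def IsBigORpow [Norm F] (f : E → F) (s : ℝ) : Prop :=
  f =O[cobounded E] fun x => ‖x‖ ^ s

theorem tendsto_norm_rpow_cobounded {s : ℝ} (hs : s < 0) :
    Tendsto (fun x : E => ‖x‖ ^ s) (cobounded E) (𝓝 0) := by
  simpa [Function.comp_def] using
    (tendsto_rpow_neg_atTop (neg_pos.2 hs)).comp (tendsto_norm_cobounded_atTop (E := E))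

namespace IsBigORpow

theorem mono [Norm F] {f : E → F} {s t : ℝ} (hf : IsBigORpow f s) (hst : s ≤ t) :
    IsBigORpow f t := by
  refine hf.trans (.of_bound' ?_)
  filter_upwards [tendsto_norm_cobounded_atTop.eventually_ge_atTop 1] with x hx
  rw [Real.norm_of_nonneg (by positivity), Real.norm_of_nonneg (by positivity)]
  exact Real.rpow_le_rpow_of_exponent_le hx hst

theorem congr' [Norm F] {f g : E → F} {s : ℝ} (hf : IsBigORpow f s) (hfg : f =ᶠ[cobounded E] g) :
    IsBigORpow g s :=
  Asymptotics.IsBigO.congr' hf hfg .rfl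

theorem mul {R : Type*} [NormedRing R] {f g : E → R} {s t u : ℝ} (hf : IsBigORpow f s)
    (hg : IsBigORpow g t) (hu : s + t = u) : IsBigORpow (fun x => f x * g x) u := by
  refine (Asymptotics.IsBigO.mul hf hg).congr' .rfl ?_
  filter_upwards [tendsto_norm_cobounded_atTop.eventually_gt_atTop 0] with x hx
  rw [← Real.rpow_add hx, hu]

variable [NormedAddCommGroup F] {f g : E → F} {s : ℝ}

theorem add (hf : IsBigORpow f s) (hg : IsBigORpow g s) : IsBigORpow (fun x => f x + g x) s :=
  Asymptotics.IsBigO.add hf hg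

theorem sub (hf : IsBigORpow f s) (hg : IsBigORpow g s) : IsBigORpow (fun x => f x - g x) s :=
  Asymptotics.IsBigO.sub hf hg

theorem neg (hf : IsBigORpow f s) : IsBigORpow (fun x => -f x) s :=
  Asymptotics.IsBigO.neg_left hf

theorem const_smul [NormedSpace ℝ F] (c : ℝ) (hf : IsBigORpow f s) :
    IsBigORpow (fun x => c • f x) s :=
  Asymptotics.IsBigO.const_smul_left hf c

theorem sum {ι : Type*} {A : Finset ι} {f : ι → E → F} (hf : ∀ i ∈ A, IsBigORpow (f i) s) :
    IsBigORpow (fun x => ∑ i ∈ A, f i x) s :=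
  Asymptotics.IsBigO.fun_sum hf

theorem of_sub (hfg : IsBigORpow (fun x => f x - g x) s) (hg : IsBigORpow g s) :
    IsBigORpow f s :=
  (hfg.add hg).congr' (.of_eq (funext fun x => sub_add_cancel (f x) (g x)))

theorem tendsto_zero (hf : IsBigORpow f s) (hs : s < 0) : Tendsto f (cobounded E) (𝓝 0) :=
  Asymptotics.IsBigO.trans_tendsto hf (tendsto_norm_rpow_cobounded hs)

theorem of_tendsto {a : F} (hf : Tendsto f (cobounded E) (𝓝 a)) : IsBigORpow f 0 := by
  simpa only [IsBigORpow, Real.rpow_zero] using hf.isBigO_one ℝ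

theorem sum_mul_sub {ι : Type*} [Fintype ι] [DecidableEq ι] {A b : ι → E → ℝ} {p : ι}
    {s t u : ℝ} (hA : ∀ i, IsBigORpow (fun x => A i x - (1 : Matrix ι ι ℝ) i p) s)
    (hb : ∀ i, IsBigORpow (b i) t) (hu : s + t = u) :
    IsBigORpow (fun x => ∑ i, A i x * b i x - b p x) u := by
  refine (sum fun i (_ : i ∈ Finset.univ) => (hA i).mul (hb i) hu).congr' (.of_eq ?_)
  ext x
  simp [sub_mul, Matrix.one_apply]

end IsBigORpow

end Decay

/-! ### Matrix-valued functions -/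

section MatrixCalculus

attribute [local instance] Matrix.linftyOpNormedRing Matrix.linftyOpNormedAlgebra

variable {ι : Type*} [Fintype ι] [DecidableEq ι] {E : Type*} [NormedAddCommGroup E]

/-- A matrix as the family of its entries. Any two norms being equivalent, it transfers calculus
statements between the operator norm and the entries. -/
noncomputable def matrixEquivPi : Matrix ι ι ℝ ≃L[ℝ] (ι → ι → ℝ) :=
  (Matrix.ofLinearEquiv ℝ).symm.toContinuousLinearEquiv

theorem isBigORpow_matrix_iff {M : E → Matrix ι ι ℝ} {s : ℝ} :
    IsBigORpow M s ↔ ∀ i j, IsBigORpow (fun x => M x i j) s := by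
  have hpi : IsBigORpow (fun x => matrixEquivPi (M x)) s ↔ ∀ i j, IsBigORpow (fun x => M x i j) s :=
    Asymptotics.isBigO_pi.trans (forall_congr' fun i => Asymptotics.isBigO_pi)
  rw [← hpi]
  have hle := ContinuousLinearEquiv.isBigO_comp (matrixEquivPi (ι := ι)) M (cobounded E)
  have hge := ContinuousLinearEquiv.isBigO_comp_rev (matrixEquivPi (ι := ι)) M (cobounded E)
  exact ⟨fun h => hle.trans h, fun h => hge.trans h⟩

theorem contDiffAt_matrix_iff [NormedSpace ℝ E] {M : E → Matrix ι ι ℝ} {m : ℕ∞ω} {x : E} :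
    ContDiffAt ℝ m M x ↔ ∀ i j, ContDiffAt ℝ m (fun y => M y i j) x := by
  rw [← matrixEquivPi.comp_contDiffAt_iff]
  exact contDiffAt_pi.trans (forall_congr' fun i => contDiffAt_pi)

omit [Fintype ι] [DecidableEq ι] in
theorem fderiv_matrix_apply [Finite ι] [NormedSpace ℝ E] {M : E → Matrix ι ι ℝ} {x : E}
    (hM : DifferentiableAt ℝ M x) (v : E) (i j : ι) :
    fderiv ℝ M x v i j = fderiv ℝ (fun y => M y i j) x v := by
  classical
  cases nonempty_fintype ι
  have hpi := hasFDerivAt_pi'.1 (hasFDerivAt_pi'.1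
    (matrixEquivPi.hasFDerivAt.comp x hM.hasFDerivAt) i) j
  exact congrArg (fun L : E →L[ℝ] ℝ => L v) hpi.fderiv.symm

theorem fderiv_matrix_inv [NormedSpace ℝ E] {M : E → Matrix ι ι ℝ} {x : E}
    (hM : DifferentiableAt ℝ M x) (hx : IsUnit (M x)) (v : E) :
    fderiv ℝ (fun y => (M y)⁻¹) x v = -((M x)⁻¹ * fderiv ℝ M x v * (M x)⁻¹) := by
  obtain ⟨u, hu⟩ := hx
  have hinv : HasFDerivAt (fun y => Ring.inverse (M y)) _ x :=
    (hu ▸ hasFDerivAt_ringInverse (𝕜 := ℝ) u).comp x hM.hasFDerivAt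
  simp only [Matrix.nonsing_inv_eq_ringInverse, hinv.fderiv, ← hu, Ring.inverse_unit]
  rfl

theorem contDiffAt_matrix_inv [NormedSpace ℝ E] {M : E → Matrix ι ι ℝ} {m : ℕ∞ω} {x : E}
    (hM : ContDiffAt ℝ m M x) (hx : IsUnit (M x)) : ContDiffAt ℝ m (fun y => (M y)⁻¹) x := by
  simp only [Matrix.nonsing_inv_eq_ringInverse]
  obtain ⟨u, hu⟩ := hx
  exact (hu ▸ contDiffAt_ringInverse ℝ u : ContDiffAt ℝ m Ring.inverse (M x)).comp x hM

end MatrixCalculus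

/-! ### Square roots near the identity -/

section SquareRoot

theorem exists_local_sqrt (A : Type*) [NormedRing A] [NormedAlgebra ℝ A] [CompleteSpace A] :
    ∃ s : A → A, (∀ᶠ P in 𝓝 1, ContDiffAt ℝ 1 s P) ∧ ∀ᶠ Y in 𝓝 1, s (Y * Y) = Y := by
  let f : A → A := fun Y => Y * Y
  let f' : A ≃L[ℝ] A := ContinuousLinearEquiv.smulLeft (Units.mk0 (2 : ℝ) two_ne_zero)
  have hf : ContDiffAt ℝ 1 f 1 := contDiffAt_id.mul contDiffAt_id
  have hf' : HasFDerivAt f (f' : A →L[ℝ] A) 1 := by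
    have hmul := (hasFDerivAt_id (𝕜 := ℝ) (1 : A)).mul' (hasFDerivAt_id (𝕜 := ℝ) (1 : A))
    refine hmul.congr_fderiv (ContinuousLinearMap.ext fun Y => ?_)
    change 1 * Y + Y * 1 = (2 : ℝ) • Y
    rw [one_mul, mul_one, two_smul]
  have hf1 : f 1 = 1 := one_mul 1
  exact ⟨hf.localInverse hf' one_ne_zero,
    (hf1 ▸ hf.to_localInverse hf' one_ne_zero).eventually (by simp),
    (hf.hasStrictFDerivAt' hf' one_ne_zero).eventually_left_inverse⟩

theorem norm_sub_half_smul_le {A : Type*} [NormedRing A] [NormedAlgebra ℝ A] {H D Q : A}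
    (hQ : H * D + D * H = Q) (hH : ‖H - 1‖ ≤ 1 / 2) :
    ‖D - (1 / 2 : ℝ) • Q‖ ≤ ‖H - 1‖ * ‖Q‖ := by
  have hremainder : ‖D - (1 / 2 : ℝ) • Q‖ ≤ ‖H - 1‖ * ‖D‖ := by
    have hsplit : D - (1 / 2 : ℝ) • Q = -(1 / 2 : ℝ) • ((H - 1) * D + D * (H - 1)) := by
      rw [← hQ, sub_mul, mul_sub, one_mul, mul_one]
      module
    rw [hsplit, norm_smul, norm_neg, Real.norm_of_nonneg (by norm_num)]
    linarith [norm_add_le ((H - 1) * D) (D * (H - 1)), norm_mul_le (H - 1) D,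
      norm_mul_le D (H - 1), mul_comm ‖D‖ ‖H - 1‖]
  have hD : ‖D‖ ≤ ‖Q‖ := by
    have hhalf : ‖(1 / 2 : ℝ) • Q‖ = 1 / 2 * ‖Q‖ := by
      rw [norm_smul, Real.norm_of_nonneg (by norm_num)]
    have hsmall := mul_le_mul_of_nonneg_right hH (norm_nonneg D)
    linarith [norm_le_norm_add_norm_sub' D ((1 / 2 : ℝ) • Q)]
  exact hremainder.trans (by gcongr)

theorem abs_sub_one_le_of_mul_self_eq {ι : Type*} [Fintype ι] [DecidableEq ι]
    {H P : Matrix ι ι ℝ} (hH : H.PosSemidef) (hHP : H * H = P) (i j : ι) :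
    |(H - 1) i j| ≤ ∑ l, |(P - 1) l j| := by
  set v : ι → ℝ := (H - 1).col j
  set w : ι → ℝ := (P - 1).col j
  have hv : H *ᵥ v + v = w := by
    have hfactor : H * (H - 1) + (H - 1) = P - 1 := by rw [← hHP]; noncomm_ring
    ext l
    exact congrFun (congrFun hfactor l) j
  -- `|w|² = |Hv|² + 2⟨v, Hv⟩ + |v|²` and `⟨v, Hv⟩ ≥ 0`
  have hvw : v ⬝ᵥ v ≤ w ⬝ᵥ w := by
    have hquadratic : 0 ≤ v ⬝ᵥ (H *ᵥ v) := by simpa using hH.dotProduct_mulVec_nonneg v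
    have hsq : 0 ≤ (H *ᵥ v) ⬝ᵥ (H *ᵥ v) := Finset.sum_nonneg fun l _ => mul_self_nonneg _
    rw [← hv, add_dotProduct, dotProduct_add, dotProduct_add, dotProduct_comm (H *ᵥ v) v]
    linarith
  have hsingle : v i ^ 2 ≤ v ⬝ᵥ v := by
    rw [sq]
    exact Finset.single_le_sum (f := fun l => v l * v l) (fun l _ => mul_self_nonneg _)
      (Finset.mem_univ i)
  have hsum : w ⬝ᵥ w ≤ (∑ l, |w l|) ^ 2 := by
    simpa [dotProduct, sq] using
      Finset.sum_sq_le_sq_sum_of_nonneg fun l (_ : l ∈ Finset.univ) => abs_nonneg (w l)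
  exact abs_le_of_sq_le_sq (hsingle.trans (hvw.trans hsum))
    (Finset.sum_nonneg fun l _ => abs_nonneg _)

variable {n : ℕ} {G : Eucl n → Matrix (Fin n) (Fin n) ℝ} {x : Eucl n}

open scoped MatrixOrder in
theorem frameMap_mul_self (hG : (G x).PosSemidef) : frameMap G x * frameMap G x = (G x)⁻¹ :=
  CFC.sqrt_mul_sqrt_self _ hG.inv.nonneg

open scoped MatrixOrder in
theorem frameMap_posSemidef : (frameMap G x).PosSemidef :=
  Matrix.nonneg_iff_posSemidef.1 (CFC.sqrt_nonneg _)

end SquareRoot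

/-! ### Asymptotically Euclidean metrics -/

/-- The coefficients of a Riemannian metric near infinity that is asymptotic of order `τ > 0` to
the Euclidean one, together with its first two derivatives. -/
structure IsAsymptoticallyEuclidean {n : ℕ} (G : Eucl n → Matrix (Fin n) (Fin n) ℝ) (τ : ℝ) :
    Prop where
  order_pos : 0 < τ
  posSemidef : ∀ᶠ x in cobounded (Eucl n), (G x).PosSemidef
  contDiffAt : ∀ᶠ x in cobounded (Eucl n), ∀ i j, ContDiffAt ℝ 2 (fun y => G y i j) x
  decay_zero : ∀ i j, IsBigORpow (fun x => G x i j - (1 : Matrix (Fin n) (Fin n) ℝ) i j) (-τ)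
  decay_one : ∀ i j k, IsBigORpow (fun x => pd k (fun y => G y i j) x) (-τ - 1)
  decay_two : ∀ i j k l, IsBigORpow (fun x => pd k (pd l fun y => G y i j) x) (-τ - 2)

namespace IsAsymptoticallyEuclidean

attribute [local instance] Matrix.linftyOpNormedRing Matrix.linftyOpNormedAlgebra

variable {n : ℕ} {G : Eucl n → Matrix (Fin n) (Fin n) ℝ} {τ : ℝ}

theorem contDiffAt_matrix (h : IsAsymptoticallyEuclidean G τ) :
    ∀ᶠ x in cobounded (Eucl n), ContDiffAt ℝ 2 G x :=
  h.contDiffAt.mono fun _ hx => contDiffAt_matrix_iff.2 hx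

theorem decay_sub_one (h : IsAsymptoticallyEuclidean G τ) : IsBigORpow (fun x => G x - 1) (-τ) :=
  isBigORpow_matrix_iff.2 h.decay_zero

theorem tendsto_one (h : IsAsymptoticallyEuclidean G τ) : Tendsto G (cobounded (Eucl n)) (𝓝 1) :=
  tendsto_sub_nhds_zero_iff.1 (h.decay_sub_one.tendsto_zero (neg_neg_of_pos h.order_pos))

theorem eventually_isUnit (h : IsAsymptoticallyEuclidean G τ) :
    ∀ᶠ x in cobounded (Eucl n), IsUnit (G x) :=
  h.tendsto_one.eventually (Units.isOpen.mem_nhds isUnit_one)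

theorem contDiffAt_inv (h : IsAsymptoticallyEuclidean G τ) :
    ∀ᶠ x in cobounded (Eucl n), ContDiffAt ℝ 2 (fun y => (G y)⁻¹) x := by
  filter_upwards [h.contDiffAt_matrix, h.eventually_isUnit] with x hG hx
  exact contDiffAt_matrix_inv hG hx

theorem inv_tendsto_one (h : IsAsymptoticallyEuclidean G τ) :
    Tendsto (fun x => (G x)⁻¹) (cobounded (Eucl n)) (𝓝 1) := by
  simp only [Matrix.nonsing_inv_eq_ringInverse]
  have hcont := NormedRing.inverse_continuousAt (1 : (Matrix (Fin n) (Fin n) ℝ)ˣ)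
  have hlim := hcont.tendsto.comp h.tendsto_one
  rwa [Units.val_one, Ring.inverse_one] at hlim

theorem decay_inv_sub_one (h : IsAsymptoticallyEuclidean G τ) :
    IsBigORpow (fun x => (G x)⁻¹ - 1) (-τ) := by
  refine ((IsBigORpow.of_tendsto h.inv_tendsto_one).mul h.decay_sub_one (zero_add _)).neg.congr' ?_
  filter_upwards [h.eventually_isUnit] with x hx
  rw [mul_sub, Matrix.nonsing_inv_mul _ ((Matrix.isUnit_iff_isUnit_det _).1 hx), mul_one, neg_sub]

theorem decay_inv_apply_sub_one (h : IsAsymptoticallyEuclidean G τ) (k l : Fin n) :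
    IsBigORpow (fun x => (G x)⁻¹ k l - (1 : Matrix (Fin n) (Fin n) ℝ) l k) (-τ) := by
  simpa [Matrix.one_apply, eq_comm] using isBigORpow_matrix_iff.1 h.decay_inv_sub_one k l

theorem decay_fderiv (h : IsAsymptoticallyEuclidean G τ) (k : Fin n) :
    IsBigORpow (fun x => fderiv ℝ G x (stdVec k)) (-τ - 1) := by
  refine isBigORpow_matrix_iff.2 fun i j => (h.decay_one i j k).congr' ?_
  filter_upwards [h.contDiffAt_matrix] with x hx
  exact (fderiv_matrix_apply (hx.differentiableAt two_ne_zero) _ i j).symm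

theorem decay_fderiv_inv_add (h : IsAsymptoticallyEuclidean G τ) (k : Fin n) :
    IsBigORpow (fun x => fderiv ℝ (fun y => (G y)⁻¹) x (stdVec k) + fderiv ℝ G x (stdVec k))
      (-2 * τ - 1) := by
  have hleft := (h.decay_inv_sub_one.mul (h.decay_fderiv k) rfl).mul
    (IsBigORpow.of_tendsto h.inv_tendsto_one) (by ring : _ = -2 * τ - 1)
  have hright := (h.decay_fderiv k).mul h.decay_inv_sub_one (by ring : _ = -2 * τ - 1)
  refine (hleft.add hright).neg.congr' ?_
  filter_upwards [h.contDiffAt_matrix, h.eventually_isUnit] with x hG hx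
  rw [fderiv_matrix_inv (hG.differentiableAt two_ne_zero) hx]
  noncomm_ring

theorem decay_fderiv_inv (h : IsAsymptoticallyEuclidean G τ) (k : Fin n) :
    IsBigORpow (fun x => fderiv ℝ (fun y => (G y)⁻¹) x (stdVec k)) (-τ - 1) := by
  have hle : -2 * τ - 1 ≤ -τ - 1 := by linarith [h.order_pos]
  simpa only [add_sub_cancel_right] using
    ((h.decay_fderiv_inv_add k).mono hle).sub (h.decay_fderiv k)

theorem decay_frameMap_sub_one (h : IsAsymptoticallyEuclidean G τ) :
    IsBigORpow (fun x => frameMap G x - 1) (-τ) := by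
  refine isBigORpow_matrix_iff.2 fun i j => ?_
  have hcolumn : IsBigORpow (fun x => ∑ l, |((G x)⁻¹ - 1) l j|) (-τ) :=
    .sum fun l _ => (isBigORpow_matrix_iff.1 h.decay_inv_sub_one l j).abs_left
  refine .trans (.of_bound' ?_) hcolumn
  filter_upwards [h.posSemidef] with x hx
  rw [Real.norm_eq_abs, Real.norm_of_nonneg (Finset.sum_nonneg fun l _ => abs_nonneg _)]
  exact abs_sub_one_le_of_mul_self_eq frameMap_posSemidef (frameMap_mul_self hx) i j

theorem frameMap_tendsto_one (h : IsAsymptoticallyEuclidean G τ) :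
    Tendsto (frameMap G) (cobounded (Eucl n)) (𝓝 1) :=
  tendsto_sub_nhds_zero_iff.1 (h.decay_frameMap_sub_one.tendsto_zero (neg_neg_of_pos h.order_pos))

theorem contDiffAt_frameMap (h : IsAsymptoticallyEuclidean G τ) :
    ∀ᶠ x in cobounded (Eucl n), ContDiffAt ℝ 1 (frameMap G) x := by
  obtain ⟨s, hs, hs_sq⟩ := exists_local_sqrt (Matrix (Fin n) (Fin n) ℝ)
  filter_upwards [h.inv_tendsto_one.eventually hs, h.contDiffAt_inv, eventually_cobounded_nhds
    (h.posSemidef.and (h.frameMap_tendsto_one.eventually hs_sq))] with x hsx hinv hnhds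
  refine (hsx.comp x (hinv.of_le one_le_two)).congr_of_eventuallyEq ?_
  filter_upwards [hnhds] with y ⟨hy, hsy⟩
  rw [Function.comp_apply, ← frameMap_mul_self hy, hsy]

theorem frameMap_mul_fderiv_add (h : IsAsymptoticallyEuclidean G τ) :
    ∀ᶠ x in cobounded (Eucl n), ∀ k,
      frameMap G x * fderiv ℝ (frameMap G) x (stdVec k) +
        fderiv ℝ (frameMap G) x (stdVec k) * frameMap G x =
          fderiv ℝ (fun y => (G y)⁻¹) x (stdVec k) := by
  filter_upwards [h.contDiffAt_frameMap, eventually_cobounded_nhds h.posSemidef] with x hx hpos k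
  have hsq : (fun y => (G y)⁻¹) =ᶠ[𝓝 x] frameMap G * frameMap G := by
    filter_upwards [hpos] with y hy using (frameMap_mul_self hy).symm
  have hderiv := (hx.differentiableAt one_ne_zero).hasFDerivAt
  exact congrArg (fun L => L (stdVec k))
    ((hderiv.mul' hderiv).fderiv.symm.trans hsq.fderiv_eq.symm)

theorem decay_fderiv_frameMap_add (h : IsAsymptoticallyEuclidean G τ) (k : Fin n) :
    IsBigORpow (fun x => fderiv ℝ (frameMap G) x (stdVec k) +
      (1 / 2 : ℝ) • fderiv ℝ G x (stdVec k)) (-2 * τ - 1) := by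
  have hsqrt : IsBigORpow (fun x => fderiv ℝ (frameMap G) x (stdVec k) -
      (1 / 2 : ℝ) • fderiv ℝ (fun y => (G y)⁻¹) x (stdVec k)) (-2 * τ - 1) := by
    refine .trans (.of_bound' ?_) (IsBigORpow.mul (f := fun x => ‖frameMap G x - 1‖)
      (g := fun x => ‖fderiv ℝ (fun y => (G y)⁻¹) x (stdVec k)‖)
      h.decay_frameMap_sub_one.norm_left (h.decay_fderiv_inv k).norm_left (by ring))
    have hclose := (tendsto_sub_nhds_zero_iff.2 h.frameMap_tendsto_one).norm
    rw [norm_zero] at hclose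
    filter_upwards [h.frameMap_mul_fderiv_add, hclose.eventually_le_const one_half_pos]
      with x hx hsmall
    rw [Real.norm_of_nonneg (by positivity)]
    exact norm_sub_half_smul_le (hx k) hsmall
  have hinv := (h.decay_fderiv_inv_add k).const_smul (1 / 2)
  refine (hsqrt.add hinv).congr' (.of_eq (funext fun x => ?_))
  module

theorem decay_pd_inv_apply (h : IsAsymptoticallyEuclidean G τ) (k i j : Fin n) :
    IsBigORpow (fun x => pd k (fun y => (G y)⁻¹ i j) x) (-τ - 1) := by
  refine (isBigORpow_matrix_iff.1 (h.decay_fderiv_inv k) i j).congr' ?_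
  filter_upwards [h.contDiffAt_inv] with x hx
  exact fderiv_matrix_apply (hx.differentiableAt two_ne_zero) _ i j

theorem decay_pd_frameMap_apply_add (h : IsAsymptoticallyEuclidean G τ) (k i j : Fin n) :
    IsBigORpow (fun x => pd k (fun y => frameMap G y i j) x + 1 / 2 * pd k (fun y => G y i j) x)
      (-2 * τ - 1) := by
  refine (isBigORpow_matrix_iff.1 (h.decay_fderiv_frameMap_add k) i j).congr' ?_
  filter_upwards [h.contDiffAt_frameMap, h.contDiffAt_matrix] with x hH hG
  rw [pd, pd, ← fderiv_matrix_apply (hH.differentiableAt one_ne_zero),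
    ← fderiv_matrix_apply (hG.differentiableAt two_ne_zero)]
  rfl

theorem decay_mul_frameMap_apply_sub_one (h : IsAsymptoticallyEuclidean G τ) (l k : Fin n) :
    IsBigORpow (fun x => (G x * frameMap G x) l k - (1 : Matrix (Fin n) (Fin n) ℝ) l k) (-τ) := by
  have hmul : IsBigORpow (fun x => G x * frameMap G x - 1) (-τ) := by
    refine ((h.decay_sub_one.mul (.of_tendsto h.frameMap_tendsto_one) (add_zero _)).add
      h.decay_frameMap_sub_one).congr' (.of_eq (funext fun x => ?_))
    rw [sub_mul, one_mul, sub_add_sub_cancel]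
  exact isBigORpow_matrix_iff.1 hmul l k

theorem pd_apply_comm (h : IsAsymptoticallyEuclidean G τ) :
    ∀ᶠ x in cobounded (Eucl n), ∀ k i j,
      pd k (fun y => G y i j) x = pd k (fun y => G y j i) x := by
  filter_upwards [eventually_cobounded_nhds h.posSemidef] with x hx k i j
  have hsymm : (fun y => G y i j) =ᶠ[𝓝 x] fun y => G y j i := by
    filter_upwards [hx] with y hy using by simpa using hy.isHermitian.apply j i
  rw [pd, hsymm.fderiv_eq, pd]

end IsAsymptoticallyEuclidean

/-! ### Linearization of the connection and of the scalar curvature -/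

section Linearization

variable {n : ℕ}

theorem contDiffAt_pd {f : Eucl n → ℝ} {x : Eucl n} (hf : ContDiffAt ℝ 2 f x) (k : Fin n) :
    ContDiffAt ℝ 1 (pd k f) x :=
  (hf.fderiv_right (m := 1) one_add_one_eq_two.le).clm_apply contDiffAt_const

theorem pd_sum_mul {ι : Type*} {s : Finset ι} {a b : ι → Eucl n → ℝ} {x : Eucl n}
    (ha : ∀ i ∈ s, DifferentiableAt ℝ (a i) x) (hb : ∀ i ∈ s, DifferentiableAt ℝ (b i) x)
    (k : Fin n) :
    pd k (fun y => ∑ i ∈ s, a i y * b i y) x =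
      ∑ i ∈ s, pd k (a i) x * b i x + ∑ i ∈ s, a i x * pd k (b i) x := by
  rw [pd, fderiv_fun_sum fun i hi => (ha i hi).fun_mul (hb i hi), sum_apply,
    ← Finset.sum_add_distrib]
  refine Finset.sum_congr rfl fun i hi => ?_
  simp [fderiv_fun_mul (ha i hi) (hb i hi), pd]
  ring

variable (G : Eucl n → Matrix (Fin n) (Fin n) ℝ)

/-- The Christoffel symbol of the first kind `Γ_{l,ij}`. -/
noncomputable def christoffelFirst (x : Eucl n) (l i j : Fin n) : ℝ :=
  1 / 2 * (pd i (fun y => G y j l) x + pd j (fun y => G y i l) x - pd l (fun y => G y i j) x)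

/-- The linearization `(∂_j g_{ik} - ∂_k g_{ij}) / 2` at the Euclidean metric of the coefficient
`ω_j^k(∂_i)` of the connection form. -/
noncomputable def linConnCoeff (x : Eucl n) (i j k : Fin n) : ℝ :=
  1 / 2 * (pd j (fun y => G y i k) x - pd k (fun y => G y i j) x)

theorem christoffel_eq_sum (x : Eucl n) (k i j : Fin n) :
    christoffel G x k i j = ∑ l, (G x)⁻¹ k l * christoffelFirst G x l i j := by
  rw [christoffel, Finset.mul_sum]
  exact Finset.sum_congr rfl fun l _ => mul_left_comm _ _ _

theorem connCoeff_eq_sum (x : Eucl n) (i j k : Fin n) :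
    connCoeff G x i j k = ∑ l, (G x * frameMap G x) l k * nablaFrame G x i j l := by
  refine Finset.sum_congr rfl fun l _ => ?_
  rw [Matrix.mul_apply, Finset.sum_mul]
  exact Finset.sum_congr rfl fun p _ => mul_right_comm _ _ _

variable {G} {x : Eucl n}

theorem differentiableAt_christoffelFirst (hG : ∀ i j, ContDiffAt ℝ 2 (fun y => G y i j) x)
    (l i j : Fin n) : DifferentiableAt ℝ (fun y => christoffelFirst G y l i j) x := by
  have hpd (l i j : Fin n) : DifferentiableAt ℝ (pd l fun y => G y i j) x :=
    (contDiffAt_pd (hG i j) l).differentiableAt one_ne_zero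
  exact (((hpd i j l).fun_add (hpd j i l)).fun_sub (hpd l i j)).const_mul _

theorem pd_christoffelFirst (hG : ∀ i j, ContDiffAt ℝ 2 (fun y => G y i j) x)
    (m l i j : Fin n) :
    pd m (fun y => christoffelFirst G y l i j) x =
      1 / 2 * (pd m (pd i fun y => G y j l) x + pd m (pd j fun y => G y i l) x -
        pd m (pd l fun y => G y i j) x) := by
  have hpd (l i j : Fin n) : DifferentiableAt ℝ (fun z => pd l (fun y => G y i j) z) x :=
    (contDiffAt_pd (hG i j) l).differentiableAt one_ne_zero
  simp only [christoffelFirst]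
  rw [pd, fderiv_const_mul (((hpd i j l).fun_add (hpd j i l)).fun_sub (hpd l i j)),
    fderiv_fun_sub ((hpd i j l).fun_add (hpd j i l)) (hpd l i j),
    fderiv_fun_add (hpd i j l) (hpd j i l)]
  rfl

theorem contDiffAt_massForm (hG : ∀ i j, ContDiffAt ℝ 2 (fun y => G y i j) x) (k : Fin n) :
    ContDiffAt ℝ 1 (fun y => massForm G y k) x :=
  .sum fun i _ => (contDiffAt_pd (hG i k) i).sub (contDiffAt_pd (hG i i) k)

theorem pd_massForm (hG : ∀ i j, ContDiffAt ℝ 2 (fun y => G y i j) x) (m k : Fin n) :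
    pd m (fun y => massForm G y k) x =
      ∑ i, (pd m (pd i fun y => G y i k) x - pd m (pd k fun y => G y i i) x) := by
  have hpd (l i j : Fin n) : DifferentiableAt ℝ (fun z => pd l (fun y => G y i j) z) x :=
    (contDiffAt_pd (hG i j) l).differentiableAt one_ne_zero
  simp only [massForm]
  rw [pd, fderiv_fun_sum fun i _ => (hpd i i k).fun_sub (hpd k i i), sum_apply]
  refine Finset.sum_congr rfl fun i _ => ?_
  rw [fderiv_fun_sub (hpd i i k) (hpd k i i)]
  rfl

theorem sum_pd_christoffelFirst_sub (hG : ∀ i j, ContDiffAt ℝ 2 (fun y => G y i j) x) :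
    ∑ i, ∑ k, (pd k (fun y => christoffelFirst G y k i i) x -
      pd i (fun y => christoffelFirst G y k i k) x) = ∑ k, pd k (fun y => massForm G y k) x := by
  have hterm (i k : Fin n) : pd k (fun y => christoffelFirst G y k i i) x -
      pd i (fun y => christoffelFirst G y k i k) x = pd k (pd i fun y => G y i k) x -
        1 / 2 * pd k (pd k fun y => G y i i) x - 1 / 2 * pd i (pd i fun y => G y k k) x := by
    rw [pd_christoffelFirst hG, pd_christoffelFirst hG]
    ring
  simp only [hterm, pd_massForm hG, Finset.sum_sub_distrib]
  rw [Finset.sum_comm (f := fun i k => pd k (pd i fun y => G y i k) x),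
    Finset.sum_comm (f := fun i k => 1 / 2 * pd k (pd k fun y => G y i i) x)]
  simp only [← Finset.mul_sum]
  ring

namespace IsAsymptoticallyEuclidean

variable {τ : ℝ}

theorem decay_christoffelFirst (h : IsAsymptoticallyEuclidean G τ) (l i j : Fin n) :
    IsBigORpow (fun x => christoffelFirst G x l i j) (-τ - 1) :=
  (((h.decay_one j l i).add (h.decay_one i l j)).sub (h.decay_one i j l)).const_smul (1 / 2)

theorem decay_pd_christoffelFirst (h : IsAsymptoticallyEuclidean G τ) (m l i j : Fin n) :
    IsBigORpow (pd m fun y => christoffelFirst G y l i j) (-τ - 2) := by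
  refine ((((h.decay_two j l m i).add (h.decay_two i l m j)).sub
    (h.decay_two i j m l)).const_smul (1 / 2)).congr' ?_
  filter_upwards [h.contDiffAt] with x hG using
    (pd_christoffelFirst hG m l i j).symm

theorem decay_linConnCoeff (h : IsAsymptoticallyEuclidean G τ) (i j k : Fin n) :
    IsBigORpow (fun x => linConnCoeff G x i j k) (-τ - 1) :=
  ((h.decay_one i k j).sub (h.decay_one i j k)).const_smul (1 / 2)

theorem decay_christoffel_sub (h : IsAsymptoticallyEuclidean G τ) (k i j : Fin n) :
    IsBigORpow (fun x => christoffel G x k i j - christoffelFirst G x k i j)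
      (-2 * τ - 1) := by
  simp only [christoffel_eq_sum]
  exact .sum_mul_sub (A := fun l x => (G x)⁻¹ k l) (h.decay_inv_apply_sub_one k)
    (fun l => h.decay_christoffelFirst l i j) (by ring)

theorem decay_christoffel (h : IsAsymptoticallyEuclidean G τ) (k i j : Fin n) :
    IsBigORpow (fun x => christoffel G x k i j) (-τ - 1) :=
  ((h.decay_christoffel_sub k i j).mono (by linarith [h.order_pos])).of_sub
    (h.decay_christoffelFirst k i j)

theorem decay_nablaFrame_sub (h : IsAsymptoticallyEuclidean G τ) (i j l : Fin n) :
    IsBigORpow (fun x => nablaFrame G x i j l - linConnCoeff G x i j l)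
      (-2 * τ - 1) := by
  have hchristoffel := IsBigORpow.sum_mul_sub (A := fun m x => frameMap G x m j)
    (fun m => isBigORpow_matrix_iff.1 h.decay_frameMap_sub_one m j)
    (fun m => h.decay_christoffel l i m) (by ring : _ = -2 * τ - 1)
  refine ((h.decay_pd_frameMap_apply_add i l j).add
    (hchristoffel.add (h.decay_christoffel_sub l i j))).congr' ?_
  filter_upwards [h.pd_apply_comm] with x hcomm
  simp only [nablaFrame, mul_comm (frameMap G x _ _), christoffelFirst,
    linConnCoeff, hcomm i l j]
  ring

theorem decay_connCoeff_sub (h : IsAsymptoticallyEuclidean G τ) (i j k : Fin n) :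
    IsBigORpow (fun x => connCoeff G x i j k - linConnCoeff G x i j k)
      (-2 * τ - 1) := by
  have hnabla (l : Fin n) : IsBigORpow (fun x => nablaFrame G x i j l) (-τ - 1) :=
    ((h.decay_nablaFrame_sub i j l).mono (by linarith [h.order_pos])).of_sub
      (h.decay_linConnCoeff i j l)
  have hcontract := IsBigORpow.sum_mul_sub (A := fun l x => (G x * frameMap G x) l k)
    (h.decay_mul_frameMap_apply_sub_one · k) hnabla (by ring : _ = -2 * τ - 1)
  refine (hcontract.add (h.decay_nablaFrame_sub i j k)).congr' (.of_eq (funext fun x => ?_))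
  rw [connCoeff_eq_sum, sub_add_sub_cancel]

theorem decay_pd_christoffel_sub (h : IsAsymptoticallyEuclidean G τ) (m k i j : Fin n) :
    IsBigORpow (fun x => pd m (fun y => christoffel G y k i j) x -
      pd m (fun y => christoffelFirst G y k i j) x) (-2 * τ - 2) := by
  have hinv : IsBigORpow (fun x => ∑ l, pd m (fun y => (G y)⁻¹ k l) x *
      christoffelFirst G x l i j) (-2 * τ - 2) :=
    .sum fun l _ => (h.decay_pd_inv_apply m k l).mul (h.decay_christoffelFirst l i j) (by ring)
  have hfirst := IsBigORpow.sum_mul_sub (A := fun l x => (G x)⁻¹ k l) (h.decay_inv_apply_sub_one k)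
    (fun l => h.decay_pd_christoffelFirst m l i j) (by ring : _ = -2 * τ - 2)
  refine (hinv.add hfirst).congr' ?_
  filter_upwards [h.contDiffAt, h.contDiffAt_inv] with x hG hinv
  simp only [christoffel_eq_sum]
  rw [pd_sum_mul
    (fun l _ => (contDiffAt_matrix_iff.1 hinv k l).differentiableAt two_ne_zero)
    (fun l _ => differentiableAt_christoffelFirst hG l i j), add_sub_assoc]

theorem decay_ricci_sub (h : IsAsymptoticallyEuclidean G τ) (i j : Fin n) :
    IsBigORpow (fun x => ricci G x i j -
      ∑ k, (pd k (fun y => christoffelFirst G y k i j) x -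
        pd j (fun y => christoffelFirst G y k i k) x)) (-2 * τ - 2) := by
  have hmul (a b c a' b' c' : Fin n) : IsBigORpow
      (fun x => christoffel G x a b c * christoffel G x a' b' c')
      (-2 * τ - 2) :=
    (h.decay_christoffel a b c).mul (h.decay_christoffel a' b' c') (by ring)
  have hquadratic : IsBigORpow (fun x => ∑ k, ∑ l,
      (christoffel G x k k l * christoffel G x l i j -
        christoffel G x k j l * christoffel G x l i k))
      (-2 * τ - 2) :=
    .sum fun k _ => .sum fun l _ => (hmul _ _ _ _ _ _).sub (hmul _ _ _ _ _ _)
  have hlinear : IsBigORpow _ (-2 * τ - 2) :=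
    .sum fun k (_ : k ∈ Finset.univ) => (h.decay_pd_christoffel_sub k k i j).sub
      (h.decay_pd_christoffel_sub j k i k)
  refine (hlinear.add hquadratic).congr' (.of_eq (funext fun x => ?_))
  simp only [ricci, Finset.sum_sub_distrib]
  ring

theorem decay_ricci (h : IsAsymptoticallyEuclidean G τ) (i j : Fin n) :
    IsBigORpow (fun x => ricci G x i j) (-τ - 2) :=
  ((h.decay_ricci_sub i j).mono (by linarith [h.order_pos])).of_sub
    (.sum fun k _ =>
      (h.decay_pd_christoffelFirst k k i j).sub (h.decay_pd_christoffelFirst j k i k))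

theorem decay_scal_sub_div_massForm (h : IsAsymptoticallyEuclidean G τ) :
    IsBigORpow (fun x => scal G x - ∑ k, pd k (fun y => massForm G y k) x) (-2 * τ - 2) := by
  have htrace (i : Fin n) := IsBigORpow.sum_mul_sub (A := fun j x => (G x)⁻¹ i j)
    (h.decay_inv_apply_sub_one i) (h.decay_ricci i) (by ring : _ = -2 * τ - 2)
  have hsum : IsBigORpow _ (-2 * τ - 2) :=
    .sum fun i (_ : i ∈ Finset.univ) => (htrace i).add (h.decay_ricci_sub i i)
  refine hsum.congr' ?_
  filter_upwards [h.contDiffAt] with x hG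
  simp only [sub_add_sub_cancel, Finset.sum_sub_distrib (f := fun _ => ∑ _, _), scal,
    ← sum_pd_christoffelFirst_sub hG]

end IsAsymptoticallyEuclidean

end Linearization

/-! ### The mass -/

section Integrability

variable {E F : Type*} [NormedAddCommGroup E] [MeasurableSpace E] [BorelSpace E]
  [NormedAddCommGroup F]

instance isMeasurablyGenerated_cobounded : (cobounded E).IsMeasurablyGenerated := by
  refine ⟨fun s hs => ?_⟩
  obtain ⟨R, -, hR⟩ := exists_forall_of_eventually_cobounded hs
  exact ⟨{x | R < ‖x‖}, tendsto_norm_cobounded_atTop.eventually_gt_atTop R,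
    (isOpen_lt continuous_const continuous_norm).measurableSet, hR⟩

theorem stronglyMeasurableAtFilter_cobounded [SecondCountableTopologyEither E F] {f : E → F}
    {μ : Measure E} (hf : ∀ᶠ x in cobounded E, ContinuousAt f x) :
    StronglyMeasurableAtFilter f (cobounded E) μ := by
  obtain ⟨R, -, hR⟩ := exists_forall_of_eventually_cobounded hf
  have hcont : ContinuousOn f {x | R < ‖x‖} := fun x hx => (hR x hx).continuousWithinAt
  exact ⟨_, tendsto_norm_cobounded_atTop.eventually_gt_atTop R,
    hcont.aestronglyMeasurable (isOpen_lt continuous_const continuous_norm).measurableSet⟩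

theorem integrableAtFilter_norm_rpow_cobounded [NormedSpace ℝ E] [FiniteDimensional ℝ E]
    (μ : Measure E) [μ.IsAddHaarMeasure] {s : ℝ} (hs : s + Module.finrank ℝ E < 0) :
    IntegrableAtFilter (fun x : E => ‖x‖ ^ s) (cobounded E) μ := by
  have hbracket : Integrable (fun x : E => (1 + ‖x‖) ^ s) μ := by
    simpa using integrable_one_add_norm (μ := μ) (r := -s) (by linarith)
  have hs0 : s ≤ 0 := by linarith [(Module.finrank ℝ E).cast_nonneg (α := ℝ)]
  refine Asymptotics.IsBigO.integrableAtFilter (g := fun x => (1 + ‖x‖) ^ s) ?_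
    (measurable_norm.pow_const s).aestronglyMeasurable.stronglyMeasurableAtFilter
    (hbracket.integrableAtFilter _)
  refine .of_bound (2 ^ (-s)) ?_
  filter_upwards [tendsto_norm_cobounded_atTop.eventually_ge_atTop 1] with x hx
  rw [Real.norm_of_nonneg (by positivity), Real.norm_of_nonneg (by positivity),
    Real.rpow_neg zero_le_two, ← Real.inv_rpow zero_le_two,
    ← Real.mul_rpow (by norm_num) (by positivity)]
  exact Real.rpow_le_rpow_of_nonpos (by positivity) (by linarith) hs0

end Integrability

namespace IsAsymptoticallyEuclidean

variable {n : ℕ} {G : Eucl n → Matrix (Fin n) (Fin n) ℝ} {τ : ℝ}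

theorem eventually_half_le_sqrt_det (h : IsAsymptoticallyEuclidean G τ) :
    ∀ᶠ x in cobounded (Eucl n), 1 / 2 ≤ √(G x).det := by
  have hcont : Continuous fun A : Matrix (Fin n) (Fin n) ℝ => √A.det :=
    continuous_id.matrix_det.sqrt
  have hlim := (hcont.tendsto 1).comp h.tendsto_one
  rw [Matrix.det_one, Real.sqrt_one] at hlim
  exact hlim.eventually_const_le one_half_lt_one

theorem integrableAtFilter_div_massForm (h : IsAsymptoticallyEuclidean G τ)
    (hτ : ((n : ℝ) - 2) / 2 < τ)
    (hscal : IntegrableAtFilter (fun x => scal G x * √(G x).det) (cobounded (Eucl n))) :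
    IntegrableAtFilter (fun x => ∑ k, pd k (fun y => massForm G y k) x) (cobounded (Eucl n)) := by
  have hpow : IntegrableAtFilter (fun x : Eucl n => ‖x‖ ^ (-2 * τ - 2)) (cobounded (Eucl n)) :=
    integrableAtFilter_norm_rpow_cobounded volume (by rw [finrank_euclideanSpace_fin]; linarith)
  have hscal_le : (scal G) =O[cobounded (Eucl n)] fun x => scal G x * √(G x).det := by
    refine .of_bound 2 ?_
    filter_upwards [h.eventually_half_le_sqrt_det] with x hx
    rw [norm_mul, Real.norm_of_nonneg (Real.sqrt_nonneg _)]
    nlinarith [norm_nonneg (scal G x)]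
  have hdiv : (fun x => ∑ k, pd k (fun y => massForm G y k) x) =O[cobounded (Eucl n)]
      fun x => ‖scal G x * √(G x).det‖ + ‖‖x‖ ^ (-2 * τ - 2)‖ := by
    refine ((hscal_le.norm_right.add_add (Asymptotics.IsBigO.norm_right
      h.decay_scal_sub_div_massForm.neg)).congr_left fun x => ?_).trans (.of_bound' ?_)
    · rw [neg_sub, add_sub_cancel]
    · exact .of_forall fun x => le_of_eq (by simp)
  refine hdiv.integrableAtFilter (stronglyMeasurableAtFilter_cobounded ?_)
    (hscal.norm.add hpow.norm)
  filter_upwards [h.contDiffAt] with x hx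
  exact tendsto_finsetSum _ fun k _ =>
    ((contDiffAt_massForm hx k).continuousAt_fderiv one_ne_zero).clm_apply continuousAt_const

theorem tendsto_massIntegral [NeZero n] (h : IsAsymptoticallyEuclidean G τ)
    (hτ : ((n : ℝ) - 2) / 2 < τ)
    (hscal : IntegrableAtFilter (fun x => scal G x * √(G x).det) (cobounded (Eucl n))) :
    Tendsto (massIntegral G) atTop (𝓝 (mass G)) :=
  tendsto_flux (h.contDiffAt.mono fun _ => contDiffAt_massForm)
    (h.integrableAtFilter_div_massForm hτ hscal)

end IsAsymptoticallyEuclidean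

/-! ### The boundary terms -/

section Continuity

attribute [local instance] Matrix.linftyOpNormedRing Matrix.linftyOpNormedAlgebra

variable {n : ℕ} {G : Eucl n → Matrix (Fin n) (Fin n) ℝ} {τ : ℝ}

theorem IsAsymptoticallyEuclidean.continuousAt_connCoeff (h : IsAsymptoticallyEuclidean G τ) :
    ∀ᶠ x in cobounded (Eucl n), ∀ i j k, ContinuousAt (fun y => connCoeff G y i j k) x := by
  filter_upwards [h.contDiffAt, h.contDiffAt_inv, h.contDiffAt_frameMap] with x hG hinv hH i j k
  have hpd (l i j : Fin n) : ContinuousAt (pd l fun y => G y i j) x :=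
    (contDiffAt_pd (hG i j) l).continuousAt
  have hchristoffel (l i m : Fin n) : ContinuousAt (fun y => christoffel G y l i m) x :=
    continuousAt_const.mul <| tendsto_finsetSum _ fun p _ =>
      (contDiffAt_matrix_iff.1 hinv l p).continuousAt.mul
        (((hpd i m p).add (hpd m i p)).sub (hpd p i m))
  have hH' (l j : Fin n) : ContDiffAt ℝ 1 (fun y => frameMap G y l j) x :=
    contDiffAt_matrix_iff.1 hH l j
  have hnabla (l : Fin n) : ContinuousAt (fun y => nablaFrame G y i j l) x :=
    (((hH' l j).continuousAt_fderiv one_ne_zero).clm_apply continuousAt_const).add <|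
      tendsto_finsetSum _ fun m _ => (hchristoffel l i m).mul (hH' m j).continuousAt
  exact tendsto_finsetSum _ fun l _ => tendsto_finsetSum _ fun p _ =>
    ((hG l p).continuousAt.mul (hnabla l)).mul (hH' p k).continuousAt

end Continuity

theorem IsBigORpow.formContraction {E ι 𝕜 : Type*} [NormedAddCommGroup E] [Fintype ι]
    [LinearOrder ι] [NormedField 𝕜]
    {θ : E → ι → ι → ι → 𝕜} {s : ℝ} (hθ : ∀ i j k, IsBigORpow (fun x => θ x i j k) s)
    (t : ι → ι → ι → ι → 𝕜) (a : ι) :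
    IsBigORpow (fun x => formContraction t (θ x) a) s := by
  refine .sum fun i _ => .sum fun j _ => .sum fun k _ => ?_
  split_ifs
  · exact (Asymptotics.IsBigO.const_mul_left (hθ i j k) (t a i j k)).congr_left
      fun x => mul_comm _ _
  · exact Asymptotics.isBigO_zero _ _

section Boundary

variable {n : ℕ} {𝕜 : Type*} [RCLike 𝕜] {V : Type*} [NormedAddCommGroup V] [InnerProductSpace 𝕜 V]
  [FiniteDimensional 𝕜 V] [Module ℝ V] [IsScalarTower ℝ 𝕜 V]
  {ρ : SO n →ₗ⁅ℝ⁆ Module.End 𝕜 V} {ι : Type*} [Fintype ι] {W : ι → Submodule 𝕜 (RnTensor n V)}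
  {G : Eucl n → Matrix (Fin n) (Fin n) ℝ} {τ : ℝ}

theorem continuous_inner_pureTensor_rhoConn {r : ℝ}
    (hG : ∀ ν : sphere (0 : Eucl n) 1, ∀ i j k,
      ContinuousAt (fun y => connCoeff G y i j k) (r • (ν : Eucl n))) (α : ι → ℝ) (v : V) :
    Continuous fun ν : sphere (0 : Eucl n) 1 =>
      inner 𝕜 (pureTensor 𝕜 (ν : Eucl n) v) (weightedProj W α (rhoConn ρ G v (r • ν))) := by
  have hconn : Continuous fun ν : sphere (0 : Eucl n) 1 => rhoConn ρ G v (r • (ν : Eucl n)) := by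
    refine (PiLp.continuous_toLp 2 _).comp (continuous_pi fun i => ?_)
    refine (continuous_congr fun ν : sphere (0 : Eucl n) 1 =>
      rhoConn_apply ρ G v (r • (ν : Eucl n)) i).2 ?_
    refine continuous_finsetSum _ fun j _ => continuous_finsetSum _ fun k _ => ?_
    split_ifs
    · exact (RCLike.continuous_ofReal.comp
        (continuous_comp_smul_sphere fun ν => hG ν i j k)).smul continuous_const
    · exact continuous_const
  have htensor : Continuous fun ν : sphere (0 : Eucl n) 1 => pureTensor 𝕜 (ν : Eucl n) v :=
    (PiLp.continuous_toLp 2 _).comp (continuous_pi fun i =>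
      (RCLike.continuous_ofReal.comp (by fun_prop)).smul continuous_const)
  simp only [← weightedProjLin_apply]
  exact htensor.inner ((LinearMap.continuous_of_finiteDimensional (weightedProjLin W α)).comp hconn)

theorem formContraction_linConnCoeff (hn : 3 ≤ n) (hρ : IsIrreducibleOrthogonal ρ)
    (hW : ∀ j, IsIrreducibleSubspace (tensorAction ρ) (W j)) (α : ι → ℝ) {x : Eucl n}
    (hG : ∀ k i j, pd k (fun y => G y i j) x = pd k (fun y => G y j i) x) (a : Fin n) :
    formContraction (traceTensor ρ (weightedProjLin W α))
        (fun i j k => (linConnCoeff G x i j k : 𝕜)) a =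
      -((massConstant ρ W α * massForm G x a : ℝ) : 𝕜) := by
  have h := formContraction_eq_of_add_swap_eq (traceTensor_skew ρ (weightedProjLin W α))
    (traceTensor_add_swap_eq hn hρ hW α) (D := fun j i k => (pd j (fun y => G y i k) x : 𝕜))
    (fun j i k => congrArg _ (hG j i k)) a
  simp only [linConnCoeff, massForm]
  push_cast at h ⊢
  rw [h, mul_div_cancel_left₀ _ two_ne_zero, neg_mul]

theorem sum_inner_pureTensor_rhoConn_add (hn : 3 ≤ n) (hρ : IsIrreducibleOrthogonal ρ)
    (hW : ∀ j, IsIrreducibleSubspace (tensorAction ρ) (W j)) (α : ι → ℝ) {x : Eucl n}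
    (hG : ∀ k i j, pd k (fun y => G y i j) x = pd k (fun y => G y j i) x)
    {κ : Type*} [Fintype κ] (σ : OrthonormalBasis κ 𝕜 V) (ν : Eucl n) :
    ∑ l, inner 𝕜 (pureTensor 𝕜 ν (σ l)) (weightedProj W α (rhoConn ρ G (σ l) x)) +
        ((massConstant ρ W α * ∑ a, massForm G x a * ν a : ℝ) : 𝕜) =
      ∑ a, (ν a : 𝕜) * formContraction (traceTensor ρ (weightedProjLin W α))
        (fun i j k => (connCoeff G x i j k : 𝕜) - linConnCoeff G x i j k) a := by
  rw [sum_inner_pureTensor_rhoConn, Finset.mul_sum, RCLike.ofReal_sum, ← Finset.sum_add_distrib]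
  refine Finset.sum_congr rfl fun a _ => ?_
  rw [formContraction_sub, formContraction_linConnCoeff hn hρ hW α hG]
  push_cast
  ring

theorem exists_norm_sum_inner_pureTensor_rhoConn_add_le (h : IsAsymptoticallyEuclidean G τ)
    (hn : 3 ≤ n) (hρ : IsIrreducibleOrthogonal ρ)
    (hW : ∀ j, IsIrreducibleSubspace (tensorAction ρ) (W j)) (α : ι → ℝ)
    {κ : Type*} [Fintype κ] (σ : OrthonormalBasis κ 𝕜 V) :
    ∃ C, ∀ᶠ x in cobounded (Eucl n), ∀ ν ∈ sphere (0 : Eucl n) 1,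
      ‖∑ l, inner 𝕜 (pureTensor 𝕜 ν (σ l)) (weightedProj W α (rhoConn ρ G (σ l) x)) +
        ((massConstant ρ W α * ∑ a, massForm G x a * ν a : ℝ) : 𝕜)‖ ≤
          C * ‖x‖ ^ (-2 * τ - 1) := by
  set E : Eucl n → Fin n → 𝕜 := fun x => formContraction (traceTensor ρ (weightedProjLin W α))
    fun i j k => (connCoeff G x i j k : 𝕜) - linConnCoeff G x i j k
  have hconn (i j k : Fin n) : IsBigORpow
      (fun x => (connCoeff G x i j k : 𝕜) - linConnCoeff G x i j k) (-2 * τ - 1) := by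
    refine .of_norm_left ?_
    simpa only [← RCLike.ofReal_sub, RCLike.norm_ofReal, Real.norm_eq_abs] using
      (h.decay_connCoeff_sub i j k).norm_left
  have hE : IsBigORpow (fun x => ∑ a, ‖E x a‖) (-2 * τ - 1) :=
    .sum fun a _ => (IsBigORpow.formContraction hconn _ a).norm_left
  obtain ⟨C, hC⟩ := hE.bound
  refine ⟨C, ?_⟩
  filter_upwards [hC, h.pd_apply_comm] with x hx hcomm ν hν
  rw [Real.norm_of_nonneg (by positivity), Real.norm_of_nonneg (by positivity)] at hx
  rw [sum_inner_pureTensor_rhoConn_add hn hρ hW α hcomm]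
  refine ((norm_sum_le _ _).trans (Finset.sum_le_sum fun a _ => ?_)).trans hx
  have hνa : ‖ν a‖ ≤ 1 := (PiLp.norm_apply_le ν a).trans (mem_sphere_zero_iff_norm.1 hν).le
  rw [norm_mul, RCLike.norm_ofReal]
  exact mul_le_of_le_one_left (norm_nonneg _) hνa

theorem eventually_sum_boundaryIntegral_add (h : IsAsymptoticallyEuclidean G τ) (α : ι → ℝ)
    {κ : Type*} [Fintype κ] (σ : κ → V) (c : ℝ) :
    ∀ᶠ r in atTop, ∑ l, boundaryIntegral ρ W α G (σ l) r + ((c * massIntegral G r : ℝ) : 𝕜) =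
      sphereIntegral (fun x ν =>
        ∑ l, inner 𝕜 (pureTensor 𝕜 ν (σ l)) (weightedProj W α (rhoConn ρ G (σ l) x)) +
          ((c * ∑ a, massForm G x a * ν a : ℝ) : 𝕜)) r := by
  filter_upwards [eventually_forall_smul_sphere (h.continuousAt_connCoeff.and h.contDiffAt)]
    with r hr
  have hinner (l : κ) := continuous_inner_pureTensor_rhoConn (ρ := ρ) (W := W)
    (fun ν => (hr ν).1) α (σ l)
  have hmass : Continuous fun ν : sphere (0 : Eucl n) 1 =>
      ((c * ∑ a, massForm G (r • (ν : Eucl n)) a * (ν : Eucl n) a : ℝ) : 𝕜) :=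
    RCLike.continuous_ofReal.comp <| continuous_const.mul <| continuous_finsetSum _ fun a _ =>
      (continuous_comp_smul_sphere fun ν =>
        (contDiffAt_massForm (hr ν).2 a).continuousAt).mul (by fun_prop)
  simp only [boundaryIntegral]
  rw [← sphereIntegral_finsetSum _ fun l _ => hinner l]
  simp only [massIntegral, sphereIntegral]
  rw [integral_add (integrable_toSphere (continuous_finsetSum _ fun l _ => hinner l))
    (integrable_toSphere hmass), smul_add, integral_ofReal, integral_const_mul,
    RCLike.real_smul_eq_coe_mul (r ^ (n - 1)) ((_ : ℝ) : 𝕜), ← RCLike.ofReal_mul, smul_eq_mul,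
    mul_left_comm]

theorem tendsto_neg_sum_boundaryIntegral (h : IsAsymptoticallyEuclidean G τ) (hn : 3 ≤ n)
    (hτ : ((n : ℝ) - 2) / 2 < τ)
    (hscal : IntegrableAtFilter (fun x => scal G x * √(G x).det) (cobounded (Eucl n)))
    (hρ : IsIrreducibleOrthogonal ρ) (hW : ∀ j, IsIrreducibleSubspace (tensorAction ρ) (W j))
    (α : ι → ℝ) {κ : Type*} [Fintype κ] (σ : OrthonormalBasis κ 𝕜 V) :
    Tendsto (fun r => -∑ l, boundaryIntegral ρ W α G (σ l) r) atTop
      (𝓝 ((massConstant ρ W α * mass G : ℝ) : 𝕜)) := by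
  have : NeZero n := ⟨by lia⟩
  obtain ⟨C, hC⟩ := exists_norm_sum_inner_pureTensor_rhoConn_add_le h hn hρ hW α σ
  have hexponent : -2 * τ - 1 + ((n - 1 : ℕ) : ℝ) < 0 := by
    rw [Nat.cast_sub (by lia), Nat.cast_one]
    linarith
  have hmass : Tendsto (fun r => ((massConstant ρ W α * massIntegral G r : ℝ) : 𝕜)) atTop
      (𝓝 ((massConstant ρ W α * mass G : ℝ) : 𝕜)) :=
    (RCLike.continuous_ofReal.tendsto _).comp ((h.tendsto_massIntegral hτ hscal).const_mul _)
  have hlim := hmass.sub (tendsto_sphereIntegral_zero hexponent hC)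
  rw [sub_zero] at hlim
  refine hlim.congr' ?_
  filter_upwards [eventually_sum_boundaryIntegral_add (ρ := ρ) (W := W) h α σ
    (massConstant ρ W α)] with r hr
  rw [← hr]
  ring

end Boundary

/-! ### The end of an asymptotically flat manifold -/

namespace ChartAtInfinity

variable {n : ℕ} {M : Type*} [TopologicalSpace M] [ChartedSpace (Eucl n) M]

theorem eventually_mem_target (c : ChartAtInfinity n M) :
    ∀ᶠ x in cobounded (Eucl n), x ∈ c.Φ.target := by
  rw [c.target_eq]
  exact isBounded_def.1 isBounded_closedBall

theorem contMDiffOn_coordinateFrame [IsManifold (𝓡 n) ∞ M] (c : ChartAtInfinity n M) (i : Fin n) :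
    ContMDiffOn (𝓡 n) (𝓡 n).tangent ∞
      (fun x => (⟨c.Φ.symm x, mfderiv (𝓡 n) (𝓡 n) c.Φ.symm x (stdVec i)⟩ : TangentBundle (𝓡 n) M))
      c.Φ.target := by
  have hopen : IsOpen c.Φ.target := c.Φ.open_target
  have htangentMap := c.contMDiffOn_symm.contMDiffOn_tangentMapWithin (m := ∞) (n := ∞) (by simp)
    hopen.uniqueMDiffOn
  have hconst : ContMDiff (𝓡 n) (𝓡 n).tangent ∞
      fun x : Eucl n => (⟨x, stdVec i⟩ : TangentBundle (𝓡 n) (Eucl n)) :=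
    contMDiff_vectorSpace_iff_contDiff (V := fun _ => stdVec i).2 contDiff_const
  refine (htangentMap.comp hconst.contMDiffOn fun x hx => hx).congr fun x hx => ?_
  simp only [Function.comp_apply, tangentMapWithin, mfderivWithin_of_isOpen hopen hx]

variable [RiemannianBundle (fun p : M => TangentSpace (𝓡 n) p)]

theorem contDiffOn_metric [IsManifold (𝓡 n) ∞ M]
    [IsContMDiffRiemannianBundle (𝓡 n) ∞ (Eucl n) (fun p : M => TangentSpace (𝓡 n) p)]
    (c : ChartAtInfinity n M) (i j : Fin n) :
    ContDiffOn ℝ ∞ (fun x => c.metric x i j) c.Φ.target :=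
  contMDiffOn_iff_contDiffOn.1
    ((c.contMDiffOn_coordinateFrame i).inner_bundle (c.contMDiffOn_coordinateFrame j))

theorem posSemidef_metric (c : ChartAtInfinity n M) (x : Eucl n) : (c.metric x).PosSemidef :=
  Matrix.posSemidef_gram ℝ fun i =>
    (mfderiv (𝓡 n) (𝓡 n) c.Φ.symm x (stdVec i) : TangentSpace (𝓡 n) (c.Φ.symm x))

theorem IsAsymptoticallyFlat.isAsymptoticallyEuclidean_metric [IsManifold (𝓡 n) ∞ M]
    [IsContMDiffRiemannianBundle (𝓡 n) ∞ (Eucl n) (fun p : M => TangentSpace (𝓡 n) p)]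
    {c : ChartAtInfinity n M} {τ : ℝ} (hc : c.IsAsymptoticallyFlat τ) (hτ : 0 < τ) :
    IsAsymptoticallyEuclidean c.metric τ where
  order_pos := hτ
  posSemidef := .of_forall c.posSemidef_metric
  contDiffAt := c.eventually_mem_target.mono fun _ hx i j =>
    ((c.contDiffOn_metric i j).contDiffAt (c.Φ.open_target.mem_nhds hx)).of_le
      (WithTop.coe_le_coe.2 le_top)
  decay_zero := hc.decay_zero
  decay_one := hc.decay_one
  decay_two := hc.decay_two

theorem ScalIntegrable.integrableAtFilter {c : ChartAtInfinity n M} (hc : c.ScalIntegrable) :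
    IntegrableAtFilter (fun x => scal c.metric x * √(c.metric x).det) (cobounded (Eucl n)) :=
  ⟨_, c.eventually_mem_target, hc⟩

end ChartAtInfinity

end UniversalMass

open UniversalMass

theorem mainTheorem1_general {n : ℕ} (hn : 3 ≤ n) {G : Eucl n → Matrix (Fin n) (Fin n) ℝ} {τ : ℝ}
    (hτ : ((n : ℝ) - 2) / 2 < τ) (hG : IsAsymptoticallyEuclidean G τ)
    (hscal : IntegrableAtFilter (fun x => scal G x * √(G x).det) (Bornology.cobounded (Eucl n)))
    {𝕜 : Type*} [RCLike 𝕜] {V : Type*} [NormedAddCommGroup V] [InnerProductSpace 𝕜 V]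
    [FiniteDimensional 𝕜 V] [Module ℝ V] [IsScalarTower ℝ 𝕜 V]
    {ρ : SO n →ₗ⁅ℝ⁆ Module.End 𝕜 V} (hρ : IsIrreducibleOrthogonal ρ)
    {ι : Type*} [Fintype ι] {W : ι → Submodule 𝕜 (RnTensor n V)}
    (hW : ∀ j, IsIrreducibleSubspace (tensorAction ρ) (W j)) (a : ι → ℝ)
    {κ : Type*} [Fintype κ] (σ : OrthonormalBasis κ 𝕜 V) :
    (∀ j, ∀ t ∈ W j, confWeightOp ρ t = (confWeight ρ (W j) : 𝕜) • t) ∧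
    Tendsto (massIntegral G) atTop (𝓝 (mass G)) ∧
    Tendsto (fun r => -∑ k, boundaryIntegral ρ W a G (σ k) r) atTop
      (𝓝 ((massConstant ρ W a * mass G : ℝ) : 𝕜)) ∧
    (∀ L : κ → 𝕜,
      (∀ k, Tendsto (boundaryIntegral ρ W a G (σ k)) atTop (𝓝 (L k))) →
      -∑ k, L k = ((massConstant ρ W a * mass G : ℝ) : 𝕜)) := by
  have : NeZero n := ⟨by lia⟩
  have hmass := hG.tendsto_massIntegral hτ hscal
  have hlim := tendsto_neg_sum_boundaryIntegral hG hn hτ hscal hρ hW a σ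
  exact ⟨fun j _ => hρ.confWeightOp_eq_confWeight_smul (hW j), hmass, hlim, fun L hL =>
    tendsto_nhds_unique (tendsto_finsetSum _ fun k _ => hL k).neg hlim⟩

/-- No condition is imposed on the coefficients `a`; in particular they may be those of any
Weitzenböck formula. -/
theorem mainTheorem1
    {n : ℕ} (hn : 3 ≤ n)
    -- a complete Riemannian manifold
    {M : Type*} [EMetricSpace M] [CompleteSpace M] [ChartedSpace (Eucl n) M]
    [IsManifold (𝓡 n) ∞ M]
    [RiemannianBundle (fun p : M => TangentSpace (𝓡 n) p)]
    [IsContMDiffRiemannianBundle (𝓡 n) ∞ (Eucl n) (fun p : M => TangentSpace (𝓡 n) p)]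
    [IsRiemannianManifold (𝓡 n) M]
    -- which is asymptotically flat and has a mass
    (c : ChartAtInfinity n M) {τ : ℝ} (hτ : ((n : ℝ) - 2) / 2 < τ)
    (hflat : c.IsAsymptoticallyFlat τ) (hscal : c.ScalIntegrable)
    -- an irreducible representation of `so(n)`, real or complex
    {𝕜 : Type*} [RCLike 𝕜] {V : Type*} [NormedAddCommGroup V] [InnerProductSpace 𝕜 V]
    [FiniteDimensional 𝕜 V] [Module ℝ V] [IsScalarTower ℝ 𝕜 V]
    (ρ : SO n →ₗ⁅ℝ⁆ Module.End 𝕜 V) (hρ : IsIrreducibleOrthogonal ρ)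
    -- the splitting of `ℝⁿ ⊗ V`, real coefficients, and an orthonormal basis of `V`
    {ι : Type*} [Fintype ι] (W : ι → Submodule 𝕜 (RnTensor n V))
    (hW : IsIrreducibleDecomposition ρ W) (a : ι → ℝ)
    {κ : Type*} [Fintype κ] (σ : OrthonormalBasis κ 𝕜 V) :
    -- the conformal weights and the mass are well defined
    (∀ j, ∀ t ∈ W j, confWeightOp ρ t = (confWeight ρ (W j) : 𝕜) • t) ∧
    Tendsto (massIntegral c.metric) atTop (𝓝 (mass c.metric)) ∧
    -- the sum of the boundary terms converges to `μ(a) m(g)`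
    Tendsto (fun r => -∑ k, boundaryIntegral ρ W a c.metric (σ k) r) atTop
      (𝓝 ((massConstant ρ W a * mass c.metric : ℝ) : 𝕜)) ∧
    -- so that the sum of their limits is `μ(a) m(g)` as soon as these limits exist
    (∀ L : κ → 𝕜,
      (∀ k, Tendsto (boundaryIntegral ρ W a c.metric (σ k)) atTop (𝓝 (L k))) →
      -∑ k, L k = ((massConstant ρ W a * mass c.metric : ℝ) : 𝕜)) := by
  have hn' : (3 : ℝ) ≤ n := by exact_mod_cast hn
  exact mainTheorem1_general hn hτ (hflat.isAsymptoticallyEuclidean_metric (by linarith))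
    hscal.integrableAtFilter hρ hW.irreducible a σ
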